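/- Let $\mathbf k$ be a field of characteristic zero and let $\Omega$ be a nonempty finite set. **Conventions.** (a) A binary quadratic nonsymmetric (ns) operad is $\mathscr P(E,R)=\mathscr T(E)/\langle R\rangle$, where $\mathscr T(E)$ is the free ns operad on a space $E$ of binary operations and $R\subseteq (E\otimes E)\oplus(E\otimes E)$; in the first summand $i\otimes j$ stands for $(x\,i\,y)\,j\,z$, in the second for $x\,i\,(y\,j\,z)$. For finite-dimensional $E$ its Koszul dual is $\mathscr P^!=\mathscr P(E^*,R^\perp)$, with $R^\perp$ the orthogonal of $R$ for the natural pairing taken with sign $+$ on the first summand and $-$ on the second. The matching operad $\mathscr P_\Omega^{\mathrm{mat}}$ is presented by $\bigoplus_{\omega\in\Omega}E_\omega$ (one copy of $E$ for each $\omega$) and the relations $R^{\mu,\nu}$, $\mu,\nu\in\Omega$, obtained from $R$ by replacing each $(x\,i\,y)\,j\,z$ by $(x\,i_\mu\,y)\,j_\nu\,z$ and each $x\,i\,(y\,j\,z)$ by $x\,i_\mu\,(y\,j_\nu\,z)$. (b) A binary quadratic symmetric operad is $\mathscr P(E,R)=\mathscr T(E)/\langle R\rangle$, with $E$ an $S_2$-module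 of binary operations, $\mathscr T(E)$ the free symmetric operad and $R\subseteq\mathscr T(E)(3)=\bigoplus_{u\in\mathbb Z/3}E\otimes E$ an $S_3$-submodule, where $a\otimes b$ in component $u$ stands for $(x_u\,a\,x_{u+1})\,b\,x_{u+2}$. For finite-dimensional $E$ its Koszul dual is $\mathscr P^!=\mathscr P(E^*\otimes\mathrm{sgn},R^\perp)$, with the orthogonal for the natural pairing in each component. Its matching operad is presented by $\bigoplus_{\omega\in\Omega}E_\omega$ and the relations $R^{\mu,\nu}$, $\mu,\nu\in\Omega$, obtained from $R$ by replacing each $(x_u\,a\,x_{u+1})\,b\,x_{u+2}$ by $(x_u\,a_\mu\,x_{u+1})\,b_\nu\,x_{u+2}$. (c) An operad $\mathscr P$ is *Koszul self-dual* if $\mathscr P^!\cong\mathscr P$ as (ns, respectively symmetric) operads. **Statement.** 1. The ns operad of matching associative algebras, i.e. of vector spaces with binary operations $\cdot_\omega$ $(\omega\in\Omega)$ such that $(x\cdot_\mu y)\cdot_\nu z=x\cdot_\mu(y\cdot_\nu z)$ for all $\mu,\nu\in\Omega$ (the matching operad of the associative operad), is Koszul self-dual. 2. The symmetric operad of matching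 Poisson algebras (the matching operad of the Poisson operad) is Koszul self-dual. Its algebras are vector spaces with commutative products $\cdot_\omega$ and antisymmetric brackets $\{\,,\}_\omega$ $(\omega\in\Omega)$ such that, for all $\mu,\nu\in\Omega$, $$(x\cdot_\mu y)\cdot_\nu z=(y\cdot_\mu z)\cdot_\nu x,\qquad \{\{x,y\}_\mu,z\}_\nu+\{\{y,z\}_\mu,x\}_\nu+\{\{z,x\}_\mu,y\}_\nu=0,$$ $$\{x\cdot_\mu y,z\}_\nu=x\cdot_\nu\{y,z\}_\mu+\{x,z\}_\mu\cdot_\nu y.$$ The same holds for the variant in which the labels in the Leibniz rule are attached to the product and to the bracket, that is, in which the last identity is replaced by $$\{x\cdot_\mu y,z\}_\nu=x\cdot_\mu\{y,z\}_\nu+\{x,z\}_\nu\cdot_\mu y\qquad(\mu,\nu\in\Omega).$$ -/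

import Mathlib

open scoped TensorProduct

universe u v w

noncomputable section

/-! ### Arity bookkeeping -/

theorem arity_one_comp (n : ℕ) : (∑ _i : Fin 1, n) = n := by simp

theorem arity_comp_one (n : ℕ) : (∑ _i : Fin n, 1) = n := by simp

theorem arity_two (a b : ℕ) : (∑ i : Fin 2, (![a, b] : Fin 2 → ℕ) i) = a + b := by
  simp [Fin.sum_univ_two]

/-- `finSigmaFinEquiv` enumerates pairs `(i, a)` lexicographically, so the inputs of a two-level
composite are listed from left to right. -/
theorem arity_assoc {n : ℕ} (m : Fin n → ℕ) (l : ∀ i, Fin (m i) → ℕ) :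
    (∑ i, ∑ a, l i a) =
      ∑ j : Fin (∑ i, m i), l (finSigmaFinEquiv.symm j).1 (finSigmaFinEquiv.symm j).2 := by
  rw [Finset.sum_sigma' Finset.univ (fun _ => Finset.univ) l, Finset.univ_sigma_univ]
  exact (Equiv.sum_comp (finSigmaFinEquiv (n := m)).symm
    (fun p : (i : Fin n) × Fin (m i) => l p.1 p.2)).symm

/-- The bijection of the inputs of a composite that relabels the inputs of each upper operation. -/
def sumEquiv {n : ℕ} {m m' : Fin n → ℕ} (τ : ∀ i, Fin (m i) ≃ Fin (m' i)) :
    Fin (∑ i, m i) ≃ Fin (∑ i, m' i) :=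
  finSigmaFinEquiv.symm.trans ((Equiv.sigmaCongrRight τ).trans finSigmaFinEquiv)

/-- The bijection of the inputs of a composite that moves the blocks according to `σ`. -/
def blockEquiv {n n' : ℕ} (σ : Fin n ≃ Fin n') (m : Fin n' → ℕ) :
    Fin (∑ i, m (σ i)) ≃ Fin (∑ i, m i) :=
  finSigmaFinEquiv.symm.trans
    ((Equiv.sigmaCongrLeft (β := fun i => Fin (m i)) σ).trans finSigmaFinEquiv)

/-- Transport of an operation along an equality of arities. -/
def castOp {F : ℕ → Type v} {a b : ℕ} (h : a = b) (x : F a) : F b :=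
  cast (congrArg F h) x

theorem map_castOp {F : ℕ → Type v} {G : ℕ → Type w} (f : ∀ n, F n → G n) {a b : ℕ} (h : a = b)
    (x : F a) : f b (castOp h x) = castOp h (f a x) := by
  subst h
  rfl

/-- The pair `(x, y)` as a family indexed by `Fin 2`. -/
def opPair {F : ℕ → Type v} {a b : ℕ} (x : F a) (y : F b) :
    ∀ i : Fin 2, F ((![a, b] : Fin 2 → ℕ) i)
  | 0 => x
  | 1 => y

theorem update_opPair_zero {F : ℕ → Type v} {a b : ℕ} (x x' : F a) (y : F b) :
    Function.update (opPair x y) 0 x' = opPair x' y := by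
  funext i
  fin_cases i
  · exact Function.update_self _ _ _
  · exact Function.update_of_ne (by decide) _ _

theorem update_opPair_one {F : ℕ → Type v} {a b : ℕ} (x : F a) (y y' : F b) :
    Function.update (opPair x y) 1 y' = opPair x y' := by
  funext i
  fin_cases i
  · exact Function.update_of_ne (by decide) _ _
  · exact Function.update_self _ _ _

/-! ### The data common to nonsymmetric and symmetric operads -/

/-- An arity graded vector space with a distinguished element of arity one and multilinear
compositions, where `comp m μ ν` is `γ(μ; ν₁, …, νₙ)`. -/
structure OpCore (k : Type u) [Field k] where
  obj : ℕ → Type v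
  [addCommGroup : ∀ n, AddCommGroup (obj n)]
  [module : ∀ n, Module k (obj n)]
  one : obj 1
  comp : ∀ {n : ℕ} (m : Fin n → ℕ), obj n → (∀ i, obj (m i)) → obj (∑ i, m i)
  add_comp : ∀ {n : ℕ} (m : Fin n → ℕ) (x x' : obj n) (y : ∀ i, obj (m i)),
    comp m (x + x') y = comp m x y + comp m x' y
  smul_comp : ∀ {n : ℕ} (m : Fin n → ℕ) (c : k) (x : obj n) (y : ∀ i, obj (m i)),
    comp m (c • x) y = c • comp m x y
  comp_add : ∀ {n : ℕ} (m : Fin n → ℕ) (x : obj n) (y : ∀ i, obj (m i)) (i : Fin n)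
    (a b : obj (m i)), comp m x (Function.update y i (a + b)) =
      comp m x (Function.update y i a) + comp m x (Function.update y i b)
  comp_smul : ∀ {n : ℕ} (m : Fin n → ℕ) (x : obj n) (y : ∀ i, obj (m i)) (i : Fin n)
    (c : k) (a : obj (m i)), comp m x (Function.update y i (c • a)) =
      c • comp m x (Function.update y i a)

namespace OpCore

variable {k : Type u} [Field k]

attribute [instance] OpCore.addCommGroup OpCore.module

theorem castOp_add (P : OpCore.{u, v} k) {a b : ℕ} (h : a = b) (x y : P.obj a) :
    castOp h (x + y) = castOp h x + castOp (F := P.obj) h y := by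
  subst h
  rfl

theorem castOp_smul (P : OpCore.{u, v} k) {a b : ℕ} (h : a = b) (c : k) (x : P.obj a) :
    castOp h (c • x) = c • castOp (F := P.obj) h x := by
  subst h
  rfl

/-- Two-sided ideals with respect to composition. -/
structure OpIdeal (P : OpCore.{u, v} k) where
  carrier : ∀ n, Submodule k (P.obj n)
  comp_mem_left : ∀ {n : ℕ} (m : Fin n → ℕ) (x : P.obj n) (y : ∀ i, P.obj (m i)),
    x ∈ carrier n → P.comp m x y ∈ carrier _
  comp_mem_right : ∀ {n : ℕ} (m : Fin n → ℕ) (x : P.obj n) (y : ∀ i, P.obj (m i)) (i : Fin n),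
    y i ∈ carrier (m i) → P.comp m x y ∈ carrier _

theorem sub_comp (P : OpCore.{u, v} k) {n : ℕ} (m : Fin n → ℕ) (x x' : P.obj n)
    (y : ∀ i, P.obj (m i)) : P.comp m (x - x') y = P.comp m x y - P.comp m x' y := by
  rw [sub_eq_add_neg, ← neg_one_smul k x', P.add_comp, P.smul_comp, neg_one_smul,
    ← sub_eq_add_neg]

theorem comp_sub (P : OpCore.{u, v} k) {n : ℕ} (m : Fin n → ℕ) (x : P.obj n)
    (y : ∀ i, P.obj (m i)) (i : Fin n) (a b : P.obj (m i)) :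
    P.comp m x (Function.update y i (a - b)) =
      P.comp m x (Function.update y i a) - P.comp m x (Function.update y i b) := by
  rw [sub_eq_add_neg, ← neg_one_smul k b, P.comp_add, P.comp_smul, neg_one_smul,
    ← sub_eq_add_neg]

theorem OpIdeal.comp_sub_mem {P : OpCore.{u, v} k} (I : OpIdeal P) {n : ℕ} (m : Fin n → ℕ)
    (x x' : P.obj n) (y y' : ∀ i, P.obj (m i)) (hx : x - x' ∈ I.carrier n)
    (hy : ∀ i, y i - y' i ∈ I.carrier (m i)) :
    P.comp m x y - P.comp m x' y' ∈ I.carrier _ := by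
  have key : ∀ T : Finset (Fin n),
      P.comp m x' y - P.comp m x' (T.piecewise y' y) ∈ I.carrier _ := by
    intro T
    induction T using Finset.induction_on with
    | empty => simp
    | insert i T hi ih =>
      have h : P.comp m x' (T.piecewise y' y) - P.comp m x' ((insert i T).piecewise y' y) ∈
          I.carrier _ := by
        rw [Finset.piecewise_insert]
        have e : P.comp m x' (T.piecewise y' y) =
            P.comp m x' (Function.update (T.piecewise y' y) i (y i)) := by
          congr 1
          rw [eq_comm, Function.update_eq_self_iff]
          simp [hi]
        rw [e, ← P.comp_sub]
        exact I.comp_mem_right m x' _ i (by simpa using hy i)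
      simpa using add_mem ih h
  have h1 := key Finset.univ
  rw [Finset.piecewise_univ] at h1
  have h2 : P.comp m x y - P.comp m x' y ∈ I.carrier _ := by
    have := I.comp_mem_left m (x - x') y hx
    rwa [sub_comp] at this
  simpa using add_mem h2 h1

/-- The class of an operation modulo an ideal. -/
def OpIdeal.toQuot {P : OpCore.{u, v} k} (I : OpIdeal P) (n : ℕ) (x : P.obj n) :
    P.obj n ⧸ I.carrier n :=
  Submodule.Quotient.mk x

theorem OpIdeal.toQuot_surjective {P : OpCore.{u, v} k} (I : OpIdeal P) (n : ℕ) :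
    Function.Surjective (I.toQuot n) :=
  Submodule.Quotient.mk_surjective _

/-- Composition modulo an ideal, computed on representatives. -/
def OpIdeal.quotComp {P : OpCore.{u, v} k} (I : OpIdeal P) {n : ℕ} (m : Fin n → ℕ)
    (x : P.obj n ⧸ I.carrier n) (y : ∀ i, P.obj (m i) ⧸ I.carrier (m i)) :
    P.obj (∑ i, m i) ⧸ I.carrier (∑ i, m i) :=
  I.toQuot _ (P.comp m (Quotient.out x) (fun i => Quotient.out (y i)))

theorem OpIdeal.quotComp_mk {P : OpCore.{u, v} k} (I : OpIdeal P) {n : ℕ} (m : Fin n → ℕ)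
    (x : P.obj n) (y : ∀ i, P.obj (m i)) :
    I.quotComp m (I.toQuot n x) (fun i => I.toQuot (m i) (y i)) = I.toQuot _ (P.comp m x y) := by
  refine (Submodule.Quotient.eq _).2 (I.comp_sub_mem m _ _ _ _ ?_ ?_)
  · exact (Submodule.Quotient.eq _).1 (Quotient.out_eq _)
  · exact fun i => (Submodule.Quotient.eq _).1 (Quotient.out_eq _)

theorem OpIdeal.exists_rep {P : OpCore.{u, v} k} (I : OpIdeal P) {ι : Type*} (m : ι → ℕ)
    (y : ∀ i, P.obj (m i) ⧸ I.carrier (m i)) :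
    ∃ y' : ∀ i, P.obj (m i), y = fun i => I.toQuot (m i) (y' i) :=
  ⟨fun i => Quotient.out (y i), funext fun i => (Quotient.out_eq (y i)).symm⟩

theorem OpIdeal.update_mk {P : OpCore.{u, v} k} (I : OpIdeal P) {n : ℕ} (m : Fin n → ℕ)
    (y : ∀ i, P.obj (m i)) (i : Fin n) (c : P.obj (m i)) :
    Function.update (fun i => I.toQuot (m i) (y i)) i (I.toQuot (m i) c) =
      fun j => I.toQuot (m j) (Function.update y i c j) :=
  funext fun j => (Function.apply_update (fun i => I.toQuot (m i)) y i c j).symm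

/-- The quotient by an ideal. -/
def OpIdeal.quotient {P : OpCore.{u, v} k} (I : OpIdeal P) : OpCore.{u, v} k where
  obj n := P.obj n ⧸ I.carrier n
  one := I.toQuot 1 P.one
  comp m x y := I.quotComp m x y
  add_comp {n} m x x' y := by
    obtain ⟨x, rfl⟩ := I.toQuot_surjective _ x
    obtain ⟨x', rfl⟩ := I.toQuot_surjective _ x'
    obtain ⟨y, rfl⟩ := I.exists_rep m y
    change I.quotComp m (I.toQuot n (x + x')) _ = _
    rw [I.quotComp_mk, I.quotComp_mk, I.quotComp_mk, P.add_comp]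
    rfl
  smul_comp {n} m c x y := by
    obtain ⟨x, rfl⟩ := I.toQuot_surjective _ x
    obtain ⟨y, rfl⟩ := I.exists_rep m y
    change I.quotComp m (I.toQuot n (c • x)) _ = _
    rw [I.quotComp_mk, I.quotComp_mk, P.smul_comp]
    rfl
  comp_add {n} m x y i a b := by
    obtain ⟨x, rfl⟩ := I.toQuot_surjective _ x
    obtain ⟨y, rfl⟩ := I.exists_rep m y
    obtain ⟨a, rfl⟩ := I.toQuot_surjective _ a
    obtain ⟨b, rfl⟩ := I.toQuot_surjective _ b
    change I.quotComp m _ (Function.update _ i (I.toQuot _ (a + b))) = _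
    rw [I.update_mk, I.update_mk, I.update_mk, I.quotComp_mk, I.quotComp_mk, I.quotComp_mk,
      P.comp_add]
    rfl
  comp_smul {n} m x y i c a := by
    obtain ⟨x, rfl⟩ := I.toQuot_surjective _ x
    obtain ⟨y, rfl⟩ := I.exists_rep m y
    obtain ⟨a, rfl⟩ := I.toQuot_surjective _ a
    change I.quotComp m _ (Function.update _ i (I.toQuot _ (c • a))) = _
    rw [I.update_mk, I.update_mk, I.quotComp_mk, I.quotComp_mk, P.comp_smul]
    rfl

theorem comp_opPair_add_left (P : OpCore.{u, v} k) {a b : ℕ} (x : P.obj 2) (y y' : P.obj a)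
    (z : P.obj b) : P.comp ![a, b] x (opPair (y + y') z) =
      P.comp ![a, b] x (opPair y z) + P.comp ![a, b] x (opPair y' z) := by
  have h := P.comp_add ![a, b] x (opPair y z) 0 y y'
  have e := fun t : P.obj a => congrArg (P.comp ![a, b] x) (update_opPair_zero y t z)
  exact (e _).symm.trans (h.trans (congrArg₂ (· + ·) (e _) (e _)))

theorem comp_opPair_smul_left (P : OpCore.{u, v} k) {a b : ℕ} (x : P.obj 2) (c : k)
    (y : P.obj a) (z : P.obj b) : P.comp ![a, b] x (opPair (c • y) z) =
      c • P.comp ![a, b] x (opPair y z) := by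
  have h := P.comp_smul ![a, b] x (opPair y z) 0 c y
  have e := fun t : P.obj a => congrArg (P.comp ![a, b] x) (update_opPair_zero y t z)
  exact (e _).symm.trans (h.trans (congrArg (c • ·) (e _)))

theorem comp_opPair_add_right (P : OpCore.{u, v} k) {a b : ℕ} (x : P.obj 2) (y : P.obj a)
    (z z' : P.obj b) : P.comp ![a, b] x (opPair y (z + z')) =
      P.comp ![a, b] x (opPair y z) + P.comp ![a, b] x (opPair y z') := by
  have h := P.comp_add ![a, b] x (opPair y z) 1 z z'
  have e := fun t : P.obj b => congrArg (P.comp ![a, b] x) (update_opPair_one y z t)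
  exact (e _).symm.trans (h.trans (congrArg₂ (· + ·) (e _) (e _)))

theorem comp_opPair_smul_right (P : OpCore.{u, v} k) {a b : ℕ} (x : P.obj 2) (c : k)
    (y : P.obj a) (z : P.obj b) : P.comp ![a, b] x (opPair y (c • z)) =
      c • P.comp ![a, b] x (opPair y z) := by
  have h := P.comp_smul ![a, b] x (opPair y z) 1 c z
  have e := fun t : P.obj b => congrArg (P.comp ![a, b] x) (update_opPair_one y z t)
  exact (e _).symm.trans (h.trans (congrArg (c • ·) (e _)))

/-- `leftComb i j` is `γ(j; i, id)`, the operation `(x i y) j z`. -/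
def leftComb (P : OpCore.{u, v} k) : P.obj 2 →ₗ[k] P.obj 2 →ₗ[k] P.obj 3 :=
  LinearMap.mk₂ k (fun i j => castOp (arity_two 2 1) (P.comp ![2, 1] j (opPair i P.one)))
    (fun i i' j => by rw [P.comp_opPair_add_left, P.castOp_add])
    (fun c i j => by rw [P.comp_opPair_smul_left, P.castOp_smul])
    (fun i j j' => by rw [P.add_comp, P.castOp_add])
    (fun c i j => by rw [P.smul_comp, P.castOp_smul])

/-- `rightComb i j` is `γ(i; id, j)`, the operation `x i (y j z)`. -/
def rightComb (P : OpCore.{u, v} k) : P.obj 2 →ₗ[k] P.obj 2 →ₗ[k] P.obj 3 :=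
  LinearMap.mk₂ k (fun i j => castOp (arity_two 1 2) (P.comp ![1, 2] i (opPair P.one j)))
    (fun i i' j => by rw [P.add_comp, P.castOp_add])
    (fun c i j => by rw [P.smul_comp, P.castOp_smul])
    (fun i j j' => by rw [P.comp_opPair_add_right, P.castOp_add])
    (fun c i j => by rw [P.comp_opPair_smul_right, P.castOp_smul])

end OpCore

/-! ### Nonsymmetric operads -/

/-- Nonsymmetric operads in `k`-vector spaces. -/
structure NSOperad (k : Type u) [Field k] extends OpCore.{u, v} k where
  one_comp : ∀ {n : ℕ} (x : obj n),
    castOp (arity_one_comp n) (comp (fun _ : Fin 1 => n) one (fun _ => x)) = x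
  comp_one : ∀ {n : ℕ} (x : obj n),
    castOp (arity_comp_one n) (comp (fun _ : Fin n => 1) x (fun _ => one)) = x
  assoc : ∀ {n : ℕ} (m : Fin n → ℕ) (l : ∀ i, Fin (m i) → ℕ) (x : obj n)
    (y : ∀ i, obj (m i)) (z : ∀ i a, obj (l i a)),
    castOp (arity_assoc m l) (comp _ x (fun i => comp (l i) (y i) (z i))) =
      comp (fun j => l (finSigmaFinEquiv.symm j).1 (finSigmaFinEquiv.symm j).2) (comp m x y)
        (fun j => z (finSigmaFinEquiv.symm j).1 (finSigmaFinEquiv.symm j).2)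

namespace NSOperad

variable {k : Type u} [Field k]

/-- Isomorphisms of nonsymmetric operads. -/
structure Iso (P : NSOperad.{u, v} k) (Q : NSOperad.{u, w} k) where
  toEquiv : ∀ n, P.obj n ≃ₗ[k] Q.obj n
  map_one : toEquiv 1 P.one = Q.one
  map_comp : ∀ {n : ℕ} (m : Fin n → ℕ) (x : P.obj n) (y : ∀ i, P.obj (m i)),
    toEquiv _ (P.comp m x y) = Q.comp m (toEquiv n x) (fun i => toEquiv (m i) (y i))

/-- The operadic ideal generated by a set of operations of arbitrary arities. -/
def idealSpan (P : NSOperad.{u, v} k) (S : Set (Σ n, P.obj n)) : P.toOpCore.OpIdeal where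
  carrier n := ⨅ (I : P.toOpCore.OpIdeal) (_ : ∀ p ∈ S, p.2 ∈ I.carrier p.1), I.carrier n
  comp_mem_left m x y hx := by
    simp only [Submodule.mem_iInf] at hx ⊢
    exact fun I hI => I.comp_mem_left m x y (hx I hI)
  comp_mem_right m x y i hy := by
    simp only [Submodule.mem_iInf] at hy ⊢
    exact fun I hI => I.comp_mem_right m x y i (hy I hI)

/-- The quotient of a nonsymmetric operad by an operadic ideal. -/
def quotient (P : NSOperad.{u, v} k) (I : P.toOpCore.OpIdeal) : NSOperad.{u, v} k where
  toOpCore := I.quotient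
  one_comp {n} x := by
    obtain ⟨x, rfl⟩ := I.toQuot_surjective _ x
    change castOp (F := fun n => P.obj n ⧸ I.carrier n) _ (I.quotComp _ (I.toQuot 1 P.one) (fun _ => I.toQuot _ x)) = I.toQuot _ x
    rw [I.quotComp_mk, ← map_castOp I.toQuot, P.one_comp]
  comp_one {n} x := by
    obtain ⟨x, rfl⟩ := I.toQuot_surjective _ x
    change castOp (F := fun n => P.obj n ⧸ I.carrier n) _ (I.quotComp _ (I.toQuot n x) (fun _ => I.toQuot _ P.one)) = I.toQuot _ x
    rw [I.quotComp_mk, ← map_castOp I.toQuot, P.comp_one]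
  assoc {n} m l x y z := by
    obtain ⟨x, rfl⟩ := I.toQuot_surjective _ x
    obtain ⟨y, rfl⟩ := I.exists_rep m y
    choose z' hz' using fun i => I.exists_rep (l i) (z i)
    obtain rfl : z = fun i a => I.toQuot _ (z' i a) := funext hz'
    change castOp (F := fun n => P.obj n ⧸ I.carrier n) _ (I.quotComp _ _ (fun i => I.quotComp _ _ _)) =
      I.quotComp _ (I.quotComp _ _ _) _
    simp only [I.quotComp_mk]
    rw [← map_castOp I.toQuot, P.assoc]

end NSOperad

/-! ### The free nonsymmetric operad on a space of binary generators -/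

/-- Formal expressions built from binary generators in `E`. -/
inductive NSTerm (k : Type u) (E : Type v) : ℕ → Type (max u v)
  | gen (e : E) : NSTerm k E 2
  | one : NSTerm k E 1
  | zero (n : ℕ) : NSTerm k E n
  | add {n : ℕ} (s t : NSTerm k E n) : NSTerm k E n
  | smul {n : ℕ} (c : k) (t : NSTerm k E n) : NSTerm k E n
  | comp {n : ℕ} (m : Fin n → ℕ) (t : NSTerm k E n) (s : ∀ i, NSTerm k E (m i)) :
      NSTerm k E (∑ i, m i)

/-- The congruence on formal expressions generated by the axioms of nonsymmetric operads in
`k`-vector spaces and by the linearity of the generators. -/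
inductive NSRel (k : Type u) [Field k] (E : Type v) [AddCommGroup E] [Module k E] :
    ∀ {n : ℕ}, NSTerm k E n → NSTerm k E n → Prop
  | refl {n : ℕ} (t : NSTerm k E n) : NSRel k E t t
  | symm {n : ℕ} {s t : NSTerm k E n} : NSRel k E s t → NSRel k E t s
  | trans {n : ℕ} {r s t : NSTerm k E n} : NSRel k E r s → NSRel k E s t → NSRel k E r t
  | add_congr {n : ℕ} {s s' t t' : NSTerm k E n} : NSRel k E s s' → NSRel k E t t' →
      NSRel k E (.add s t) (.add s' t')
  | smul_congr {n : ℕ} (c : k) {t t' : NSTerm k E n} : NSRel k E t t' →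
      NSRel k E (.smul c t) (.smul c t')
  | comp_congr {n : ℕ} (m : Fin n → ℕ) {t t' : NSTerm k E n} {s s' : ∀ i, NSTerm k E (m i)} :
      NSRel k E t t' → (∀ i, NSRel k E (s i) (s' i)) → NSRel k E (.comp m t s) (.comp m t' s')
  | add_assoc {n : ℕ} (r s t : NSTerm k E n) :
      NSRel k E (.add (.add r s) t) (.add r (.add s t))
  | add_comm {n : ℕ} (s t : NSTerm k E n) : NSRel k E (.add s t) (.add t s)
  | zero_add {n : ℕ} (t : NSTerm k E n) : NSRel k E (.add (.zero n) t) t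
  | one_smul {n : ℕ} (t : NSTerm k E n) : NSRel k E (.smul 1 t) t
  | zero_smul {n : ℕ} (t : NSTerm k E n) : NSRel k E (.smul 0 t) (.zero n)
  | mul_smul {n : ℕ} (c d : k) (t : NSTerm k E n) :
      NSRel k E (.smul (c * d) t) (.smul c (.smul d t))
  | add_smul {n : ℕ} (c d : k) (t : NSTerm k E n) :
      NSRel k E (.smul (c + d) t) (.add (.smul c t) (.smul d t))
  | smul_add {n : ℕ} (c : k) (s t : NSTerm k E n) :
      NSRel k E (.smul c (.add s t)) (.add (.smul c s) (.smul c t))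
  | gen_add (e f : E) : NSRel k E (.gen (e + f)) (.add (.gen e) (.gen f))
  | gen_smul (c : k) (e : E) : NSRel k E (.gen (c • e)) (.smul c (.gen e))
  | add_comp {n : ℕ} (m : Fin n → ℕ) (t t' : NSTerm k E n) (s : ∀ i, NSTerm k E (m i)) :
      NSRel k E (.comp m (.add t t') s) (.add (.comp m t s) (.comp m t' s))
  | smul_comp {n : ℕ} (m : Fin n → ℕ) (c : k) (t : NSTerm k E n) (s : ∀ i, NSTerm k E (m i)) :
      NSRel k E (.comp m (.smul c t) s) (.smul c (.comp m t s))
  | comp_add {n : ℕ} (m : Fin n → ℕ) (t : NSTerm k E n) (s : ∀ i, NSTerm k E (m i)) (i : Fin n)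
      (a b : NSTerm k E (m i)) :
      NSRel k E (.comp m t (Function.update s i (.add a b)))
        (.add (.comp m t (Function.update s i a)) (.comp m t (Function.update s i b)))
  | comp_smul {n : ℕ} (m : Fin n → ℕ) (t : NSTerm k E n) (s : ∀ i, NSTerm k E (m i)) (i : Fin n)
      (c : k) (a : NSTerm k E (m i)) :
      NSRel k E (.comp m t (Function.update s i (.smul c a)))
        (.smul c (.comp m t (Function.update s i a)))
  | one_comp {n : ℕ} (t : NSTerm k E n) :
      NSRel k E (castOp (arity_one_comp n) (.comp (fun _ : Fin 1 => n) .one (fun _ => t))) t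
  | comp_one {n : ℕ} (t : NSTerm k E n) :
      NSRel k E (castOp (arity_comp_one n) (.comp (fun _ : Fin n => 1) t (fun _ => .one))) t
  | assoc {n : ℕ} (m : Fin n → ℕ) (l : ∀ i, Fin (m i) → ℕ) (r : NSTerm k E n)
      (s : ∀ i, NSTerm k E (m i)) (t : ∀ i a, NSTerm k E (l i a)) :
      NSRel k E
        (castOp (arity_assoc m l) (.comp _ r (fun i => .comp (l i) (s i) (t i))))
        (.comp (fun j => l (finSigmaFinEquiv.symm j).1 (finSigmaFinEquiv.symm j).2) (.comp m r s)
          (fun j => t (finSigmaFinEquiv.symm j).1 (finSigmaFinEquiv.symm j).2))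

namespace NSOperad

section Free

variable (k : Type u) [Field k] (E : Type v) [AddCommGroup E] [Module k E]

/-- Formal expressions of arity `n` modulo the operad axioms. -/
def freeSetoid (n : ℕ) : Setoid (NSTerm k E n) :=
  ⟨NSRel k E, .refl, .symm, .trans⟩

/-- The component of arity `n` of the free nonsymmetric operad. -/
def FreeObj (n : ℕ) : Type (max u v) :=
  Quotient (freeSetoid k E n)

variable {k E}

/-- The class of a formal expression. -/
def FreeObj.mk (n : ℕ) (t : NSTerm k E n) : FreeObj k E n :=
  Quotient.mk (freeSetoid k E n) t

theorem FreeObj.ind {n : ℕ} {p : FreeObj k E n → Prop} (h : ∀ t, p (FreeObj.mk n t))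
    (x : FreeObj k E n) : p x :=
  Quotient.ind h x

theorem FreeObj.sound {n : ℕ} {s t : NSTerm k E n} (h : NSRel k E s t) :
    FreeObj.mk n s = FreeObj.mk n t :=
  Quotient.sound h

instance FreeObj.instZero (n : ℕ) : Zero (FreeObj k E n) :=
  ⟨FreeObj.mk n (.zero n)⟩

instance FreeObj.instAdd (n : ℕ) : Add (FreeObj k E n) :=
  ⟨Quotient.map₂ NSTerm.add (fun _ _ h _ _ h' => NSRel.add_congr h h')⟩

instance FreeObj.instNeg (n : ℕ) : Neg (FreeObj k E n) :=
  ⟨Quotient.map (NSTerm.smul (-1)) (fun _ _ h => NSRel.smul_congr _ h)⟩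

instance FreeObj.instSMul (n : ℕ) : SMul k (FreeObj k E n) :=
  ⟨fun c => Quotient.map (NSTerm.smul c) (fun _ _ h => NSRel.smul_congr _ h)⟩

instance FreeObj.instAddCommGroup (n : ℕ) : AddCommGroup (FreeObj k E n) where
  add_assoc := FreeObj.ind fun r => FreeObj.ind fun s => FreeObj.ind fun t =>
    FreeObj.sound (NSRel.add_assoc r s t)
  add_comm := FreeObj.ind fun r => FreeObj.ind fun s => FreeObj.sound (NSRel.add_comm r s)
  zero_add := FreeObj.ind fun t => FreeObj.sound (NSRel.zero_add t)
  add_zero := FreeObj.ind fun t =>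
    FreeObj.sound ((NSRel.add_comm t _).trans (NSRel.zero_add t))
  neg_add_cancel := FreeObj.ind fun t => FreeObj.sound <| by
    have h := NSRel.add_smul (-1 : k) 1 t
    rw [neg_add_cancel] at h
    exact ((NSRel.add_congr (.refl _) (NSRel.one_smul t).symm).trans h.symm).trans
      (NSRel.zero_smul t)
  nsmul := nsmulRec
  zsmul := zsmulRec

instance FreeObj.instModule (n : ℕ) : Module k (FreeObj k E n) where
  one_smul := FreeObj.ind fun t => FreeObj.sound (NSRel.one_smul t)
  mul_smul c d := FreeObj.ind fun t => FreeObj.sound (NSRel.mul_smul c d t)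
  smul_zero c := FreeObj.sound <| by
    have h := NSRel.mul_smul c 0 (NSTerm.zero (k := k) (E := E) n)
    rw [mul_zero] at h
    exact (NSRel.smul_congr c (NSRel.zero_smul _).symm).trans (h.symm.trans (NSRel.zero_smul _))
  smul_add c := FreeObj.ind fun s => FreeObj.ind fun t => FreeObj.sound (NSRel.smul_add c s t)
  add_smul c d := FreeObj.ind fun t => FreeObj.sound (NSRel.add_smul c d t)
  zero_smul := FreeObj.ind fun t => FreeObj.sound (NSRel.zero_smul t)

/-- Composition of classes, computed on representatives. -/
def FreeObj.comp {n : ℕ} (m : Fin n → ℕ) (x : FreeObj k E n) (y : ∀ i, FreeObj k E (m i)) :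
    FreeObj k E (∑ i, m i) :=
  FreeObj.mk _ (.comp m (Quotient.out x) (fun i => Quotient.out (y i)))

theorem FreeObj.comp_mk {n : ℕ} (m : Fin n → ℕ) (t : NSTerm k E n)
    (s : ∀ i, NSTerm k E (m i)) :
    FreeObj.comp m (FreeObj.mk n t) (fun i => FreeObj.mk (m i) (s i)) =
      FreeObj.mk _ (.comp m t s) :=
  FreeObj.sound (NSRel.comp_congr m (Quotient.mk_out (s := freeSetoid k E n) t)
    (fun i => Quotient.mk_out (s := freeSetoid k E (m i)) (s i)))

theorem FreeObj.exists_rep {ι : Type*} (m : ι → ℕ) (y : ∀ i, FreeObj k E (m i)) :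
    ∃ s : ∀ i, NSTerm k E (m i), y = fun i => FreeObj.mk (m i) (s i) :=
  ⟨fun i => Quotient.out (y i), funext fun i => (Quotient.out_eq (y i)).symm⟩

theorem FreeObj.update_mk {n : ℕ} (m : Fin n → ℕ) (s : ∀ i, NSTerm k E (m i)) (i : Fin n)
    (a : NSTerm k E (m i)) :
    Function.update (fun i => FreeObj.mk (m i) (s i)) i (FreeObj.mk (m i) a) =
      fun j => FreeObj.mk (m j) (Function.update s i a j) :=
  funext fun j => (Function.apply_update (fun i => FreeObj.mk (m i)) s i a j).symm

variable (k E)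

/-- The free nonsymmetric operad on the vector space `E` of binary generators. -/
def free : NSOperad.{u, max u v} k where
  obj := FreeObj k E
  one := FreeObj.mk 1 .one
  comp m x y := FreeObj.comp m x y
  add_comp {n} m x x' y := by
    induction x using FreeObj.ind with | _ x
    induction x' using FreeObj.ind with | _ x'
    obtain ⟨y, rfl⟩ := FreeObj.exists_rep m y
    change FreeObj.comp m (FreeObj.mk n (.add x x')) _ = _
    rw [FreeObj.comp_mk, FreeObj.comp_mk, FreeObj.comp_mk]
    exact FreeObj.sound (NSRel.add_comp m x x' y)
  smul_comp {n} m c x y := by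
    induction x using FreeObj.ind with | _ x
    obtain ⟨y, rfl⟩ := FreeObj.exists_rep m y
    change FreeObj.comp m (FreeObj.mk n (.smul c x)) _ = _
    rw [FreeObj.comp_mk, FreeObj.comp_mk]
    exact FreeObj.sound (NSRel.smul_comp m c x y)
  comp_add {n} m x y i a b := by
    induction x using FreeObj.ind with | _ x
    obtain ⟨y, rfl⟩ := FreeObj.exists_rep m y
    induction a using FreeObj.ind with | _ a
    induction b using FreeObj.ind with | _ b
    change FreeObj.comp m _ (Function.update _ i (FreeObj.mk _ (.add a b))) = _
    rw [FreeObj.update_mk, FreeObj.update_mk, FreeObj.update_mk, FreeObj.comp_mk,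
      FreeObj.comp_mk, FreeObj.comp_mk]
    exact FreeObj.sound (NSRel.comp_add m x y i a b)
  comp_smul {n} m x y i c a := by
    induction x using FreeObj.ind with | _ x
    obtain ⟨y, rfl⟩ := FreeObj.exists_rep m y
    induction a using FreeObj.ind with | _ a
    change FreeObj.comp m _ (Function.update _ i (FreeObj.mk _ (.smul c a))) = _
    rw [FreeObj.update_mk, FreeObj.update_mk, FreeObj.comp_mk, FreeObj.comp_mk]
    exact FreeObj.sound (NSRel.comp_smul m x y i c a)
  one_comp {n} x := by
    induction x using FreeObj.ind with | _ x
    rw [FreeObj.comp_mk, ← map_castOp FreeObj.mk]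
    exact FreeObj.sound (NSRel.one_comp x)
  comp_one {n} x := by
    induction x using FreeObj.ind with | _ x
    rw [FreeObj.comp_mk, ← map_castOp FreeObj.mk]
    exact FreeObj.sound (NSRel.comp_one x)
  assoc {n} m l x y z := by
    induction x using FreeObj.ind with | _ x
    obtain ⟨y, rfl⟩ := FreeObj.exists_rep m y
    choose z' hz' using fun i => FreeObj.exists_rep (l i) (z i)
    obtain rfl : z = fun i a => FreeObj.mk _ (z' i a) := funext hz'
    simp only [FreeObj.comp_mk]
    rw [← map_castOp FreeObj.mk]
    exact FreeObj.sound (NSRel.assoc m l x y z')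

/-- The inclusion of the generators. -/
def freeGen : E →ₗ[k] (free k E).obj 2 where
  toFun e := FreeObj.mk 2 (.gen e)
  map_add' e f := FreeObj.sound (NSRel.gen_add e f)
  map_smul' c e := FreeObj.sound (NSRel.gen_smul c e)

end Free

end NSOperad

/-! ### Binary quadratic nonsymmetric operads -/

/-- Binary quadratic data `(E, R)`: the first summand `E ⊗ E` is the space of left combs, where
`i ⊗ j` stands for `(x i y) j z`, the second one is the space of right combs, where `i ⊗ j` stands
for `x i (y j z)`. -/
structure NSQuadData (k : Type u) [Field k] where
  E : Type v
  [addCommGroup : AddCommGroup E]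
  [module : Module k E]
  R : Submodule k ((E ⊗[k] E) × (E ⊗[k] E))

namespace NSQuadData

attribute [instance] NSQuadData.addCommGroup NSQuadData.module

variable {k : Type u} [Field k]

/-- The realization of quadratic elements as ternary operations of the free operad. -/
def realize (D : NSQuadData.{u, v} k) :
    (D.E ⊗[k] D.E) × (D.E ⊗[k] D.E) →ₗ[k] (NSOperad.free k D.E).obj 3 :=
  let T := NSOperad.free k D.E
  let g := NSOperad.freeGen k D.E
  LinearMap.coprod (TensorProduct.lift (T.leftComb.compl₁₂ g g))
    (TensorProduct.lift (T.rightComb.compl₁₂ g g))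

/-- The operad `P(E, R) = T(E) / ⟨R⟩`. -/
def operad (D : NSQuadData.{u, v} k) : NSOperad.{u, max u v} k :=
  (NSOperad.free k D.E).quotient
    ((NSOperad.free k D.E).idealSpan ((fun r => ⟨3, D.realize r⟩) '' (D.R : Set _)))

/-- The pairing of `T(E*)(3)` with `T(E)(3)`, with sign `+` on left combs and `-` on right combs. -/
def pairing (E : Type v) [AddCommGroup E] [Module k E]
    (x : (Module.Dual k E ⊗[k] Module.Dual k E) × (Module.Dual k E ⊗[k] Module.Dual k E))
    (r : (E ⊗[k] E) × (E ⊗[k] E)) : k :=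
  TensorProduct.dualDistrib k E E x.1 r.1 - TensorProduct.dualDistrib k E E x.2 r.2

/-- The quadratic data `(E*, R^⊥)` of the Koszul dual operad (for finite dimensional `E`). -/
def koszulDual (D : NSQuadData.{u, v} k) : NSQuadData.{u, max u v} k where
  E := Module.Dual k D.E
  R :=
    { carrier := {x | ∀ r ∈ D.R, pairing D.E x r = 0}
      zero_mem' := by
        intro r _
        simp [pairing]
      add_mem' := by
        intro x y hx hy r hr
        have h : pairing D.E (x + y) r = pairing D.E x r + pairing D.E y r := by
          simp only [pairing, Prod.fst_add, Prod.snd_add, map_add, LinearMap.add_apply]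
          ring
        rw [h, hx r hr, hy r hr, add_zero]
      smul_mem' := by
        intro c x hx r hr
        have h : pairing D.E (c • x) r = c * pairing D.E x r := by
          simp only [pairing, Prod.smul_fst, Prod.smul_snd, map_smul, LinearMap.smul_apply,
            smul_eq_mul]
          ring
        rw [h, hx r hr, mul_zero] }

/-- An operad is Koszul self-dual if it is isomorphic to its Koszul dual operad. -/
def IsKoszulSelfDual (D : NSQuadData.{u, v} k) : Prop :=
  Nonempty (D.koszulDual.operad.Iso D.operad)

/-- The quadratic data of the matching operad: one copy of the generators for each `ω ∈ Ω`, and for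
all `μ, ν ∈ Ω` the relations `R^{μ,ν}`, obtained from those of `R` by replacing each `(x i y) j z`
by `(x i_μ y) j_ν z` and each `x i (y j z)` by `x i_μ (y j_ν z)`. -/
def matching (Ω : Type w) (D : NSQuadData.{u, v} k) : NSQuadData.{u, max v w} k where
  E := Ω →₀ D.E
  R := ⨆ (μ : Ω) (ν : Ω), D.R.map
    ((TensorProduct.map (Finsupp.lsingle (R := k) μ) (Finsupp.lsingle (R := k) ν)).prodMap
      (TensorProduct.map (Finsupp.lsingle (R := k) μ) (Finsupp.lsingle (R := k) ν)))

variable (k) in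
/-- Associative algebras: one product, with `(x y) z - x (y z) = 0`. -/
def assoc : NSQuadData.{u, u} k where
  E := k
  R := Submodule.span k {(1 ⊗ₜ[k] 1, -(1 ⊗ₜ[k] 1))}

end NSQuadData

/-! ### Symmetric operads -/

/-- Symmetric operads in `k`-vector spaces. Input `i` of `x` becomes input `σ i` of `relabel σ x`. -/
structure SymOperad (k : Type u) [Field k] extends NSOperad.{u, v} k where
  relabel : ∀ {a b : ℕ}, (Fin a ≃ Fin b) → obj a →ₗ[k] obj b
  relabel_refl : ∀ {n : ℕ} (x : obj n), relabel (Equiv.refl (Fin n)) x = x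
  relabel_trans : ∀ {a b c : ℕ} (σ : Fin a ≃ Fin b) (τ : Fin b ≃ Fin c) (x : obj a),
    relabel τ (relabel σ x) = relabel (σ.trans τ) x
  comp_relabel : ∀ {n : ℕ} (m m' : Fin n → ℕ) (τ : ∀ i, Fin (m i) ≃ Fin (m' i)) (x : obj n)
    (y : ∀ i, obj (m i)),
    comp m' x (fun i => relabel (τ i) (y i)) = relabel (sumEquiv τ) (comp m x y)
  relabel_comp : ∀ {n n' : ℕ} (σ : Fin n ≃ Fin n') (m : Fin n' → ℕ) (x : obj n)
    (y : ∀ i, obj (m i)),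
    comp m (relabel σ x) y =
      relabel (blockEquiv σ m) (comp (fun i => m (σ i)) x (fun i => y (σ i)))

namespace SymOperad

variable {k : Type u} [Field k]

/-- Isomorphisms of symmetric operads. -/
structure Iso (P : SymOperad.{u, v} k) (Q : SymOperad.{u, w} k) extends
    NSOperad.Iso P.toNSOperad Q.toNSOperad where
  map_relabel : ∀ {a b : ℕ} (σ : Fin a ≃ Fin b) (x : P.obj a),
    toEquiv b (P.relabel σ x) = Q.relabel σ (toEquiv a x)

/-- Ideals of symmetric operads. -/
structure SymIdeal (P : SymOperad.{u, v} k) extends P.toOpCore.OpIdeal where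
  relabel_mem : ∀ {a b : ℕ} (σ : Fin a ≃ Fin b) (x : P.obj a),
    x ∈ carrier a → P.relabel σ x ∈ carrier b

/-- The ideal generated by a set of operations of arbitrary arities. -/
def idealSpan (P : SymOperad.{u, v} k) (S : Set (Σ n, P.obj n)) : P.SymIdeal where
  carrier n := ⨅ (I : P.SymIdeal) (_ : ∀ p ∈ S, p.2 ∈ I.carrier p.1), I.carrier n
  comp_mem_left m x y hx := by
    simp only [Submodule.mem_iInf] at hx ⊢
    exact fun I hI => I.comp_mem_left m x y (hx I hI)
  comp_mem_right m x y i hy := by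
    simp only [Submodule.mem_iInf] at hy ⊢
    exact fun I hI => I.comp_mem_right m x y i (hy I hI)
  relabel_mem σ x hx := by
    simp only [Submodule.mem_iInf] at hx ⊢
    exact fun I hI => I.relabel_mem σ x (hx I hI)

/-- The quotient of a symmetric operad by an ideal. -/
def quotient (P : SymOperad.{u, v} k) (I : P.SymIdeal) : SymOperad.{u, v} k where
  toNSOperad := P.toNSOperad.quotient I.toOpIdeal
  relabel {a b} σ := Submodule.mapQ (I.carrier a) (I.carrier b) (P.relabel σ)
    (fun x hx => I.relabel_mem σ x hx)
  relabel_refl {n} x := by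
    obtain ⟨x, rfl⟩ := I.toQuot_surjective _ x
    exact congrArg (I.toQuot n) (P.relabel_refl x)
  relabel_trans {a b c} σ τ x := by
    obtain ⟨x, rfl⟩ := I.toQuot_surjective _ x
    exact congrArg (I.toQuot c) (P.relabel_trans σ τ x)
  comp_relabel {n} m m' τ x y := by
    obtain ⟨x, rfl⟩ := I.toQuot_surjective _ x
    obtain ⟨y, rfl⟩ := I.exists_rep m y
    change I.quotComp m' _ (fun i => I.toQuot _ (P.relabel (τ i) (y i))) =
      Submodule.mapQ _ _ _ _ (I.quotComp m _ _)
    rw [I.quotComp_mk, I.quotComp_mk, P.comp_relabel]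
    rfl
  relabel_comp {n n'} σ m x y := by
    obtain ⟨x, rfl⟩ := I.toQuot_surjective _ x
    obtain ⟨y, rfl⟩ := I.exists_rep m y
    change I.quotComp m (I.toQuot _ (P.relabel σ x)) _ =
      Submodule.mapQ _ _ _ _ (I.quotComp _ _ _)
    rw [I.quotComp_mk, I.quotComp_mk, P.relabel_comp]
    rfl

end SymOperad

/-! ### The free symmetric operad on a space of binary generators -/

/-- Formal expressions built from binary generators in `E`, including relabelings of inputs. -/
inductive SymTerm (k : Type u) (E : Type v) : ℕ → Type (max u v)
  | gen (e : E) : SymTerm k E 2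
  | one : SymTerm k E 1
  | zero (n : ℕ) : SymTerm k E n
  | add {n : ℕ} (s t : SymTerm k E n) : SymTerm k E n
  | smul {n : ℕ} (c : k) (t : SymTerm k E n) : SymTerm k E n
  | comp {n : ℕ} (m : Fin n → ℕ) (t : SymTerm k E n) (s : ∀ i, SymTerm k E (m i)) :
      SymTerm k E (∑ i, m i)
  | relabel {a b : ℕ} (σ : Fin a ≃ Fin b) (t : SymTerm k E a) : SymTerm k E b

/-- The congruence on formal expressions generated by the axioms of symmetric operads in
`k`-vector spaces, by the linearity of the generators, and by the requirement that exchanging the two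
inputs of a generator `e` gives the generator `swap e`. -/
inductive SymRel {k : Type u} [Field k] {E : Type v} [AddCommGroup E] [Module k E]
    (swap : E →ₗ[k] E) :
    ∀ {n : ℕ}, SymTerm k E n → SymTerm k E n → Prop
  | refl {n : ℕ} (t : SymTerm k E n) : SymRel swap t t
  | symm {n : ℕ} {s t : SymTerm k E n} : SymRel swap s t → SymRel swap t s
  | trans {n : ℕ} {r s t : SymTerm k E n} : SymRel swap r s → SymRel swap s t → SymRel swap r t
  | add_congr {n : ℕ} {s s' t t' : SymTerm k E n} : SymRel swap s s' → SymRel swap t t' →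
      SymRel swap (.add s t) (.add s' t')
  | smul_congr {n : ℕ} (c : k) {t t' : SymTerm k E n} : SymRel swap t t' →
      SymRel swap (.smul c t) (.smul c t')
  | comp_congr {n : ℕ} (m : Fin n → ℕ) {t t' : SymTerm k E n} {s s' : ∀ i, SymTerm k E (m i)} :
      SymRel swap t t' → (∀ i, SymRel swap (s i) (s' i)) → SymRel swap (.comp m t s) (.comp m t' s')
  | add_assoc {n : ℕ} (r s t : SymTerm k E n) :
      SymRel swap (.add (.add r s) t) (.add r (.add s t))
  | add_comm {n : ℕ} (s t : SymTerm k E n) : SymRel swap (.add s t) (.add t s)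
  | zero_add {n : ℕ} (t : SymTerm k E n) : SymRel swap (.add (.zero n) t) t
  | one_smul {n : ℕ} (t : SymTerm k E n) : SymRel swap (.smul 1 t) t
  | zero_smul {n : ℕ} (t : SymTerm k E n) : SymRel swap (.smul 0 t) (.zero n)
  | mul_smul {n : ℕ} (c d : k) (t : SymTerm k E n) :
      SymRel swap (.smul (c * d) t) (.smul c (.smul d t))
  | add_smul {n : ℕ} (c d : k) (t : SymTerm k E n) :
      SymRel swap (.smul (c + d) t) (.add (.smul c t) (.smul d t))
  | smul_add {n : ℕ} (c : k) (s t : SymTerm k E n) :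
      SymRel swap (.smul c (.add s t)) (.add (.smul c s) (.smul c t))
  | gen_add (e f : E) : SymRel swap (.gen (e + f)) (.add (.gen e) (.gen f))
  | gen_smul (c : k) (e : E) : SymRel swap (.gen (c • e)) (.smul c (.gen e))
  | add_comp {n : ℕ} (m : Fin n → ℕ) (t t' : SymTerm k E n) (s : ∀ i, SymTerm k E (m i)) :
      SymRel swap (.comp m (.add t t') s) (.add (.comp m t s) (.comp m t' s))
  | smul_comp {n : ℕ} (m : Fin n → ℕ) (c : k) (t : SymTerm k E n) (s : ∀ i, SymTerm k E (m i)) :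
      SymRel swap (.comp m (.smul c t) s) (.smul c (.comp m t s))
  | comp_add {n : ℕ} (m : Fin n → ℕ) (t : SymTerm k E n) (s : ∀ i, SymTerm k E (m i)) (i : Fin n)
      (a b : SymTerm k E (m i)) :
      SymRel swap (.comp m t (Function.update s i (.add a b)))
        (.add (.comp m t (Function.update s i a)) (.comp m t (Function.update s i b)))
  | comp_smul {n : ℕ} (m : Fin n → ℕ) (t : SymTerm k E n) (s : ∀ i, SymTerm k E (m i)) (i : Fin n)
      (c : k) (a : SymTerm k E (m i)) :
      SymRel swap (.comp m t (Function.update s i (.smul c a)))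
        (.smul c (.comp m t (Function.update s i a)))
  | one_comp {n : ℕ} (t : SymTerm k E n) :
      SymRel swap (castOp (arity_one_comp n) (.comp (fun _ : Fin 1 => n) .one (fun _ => t))) t
  | comp_one {n : ℕ} (t : SymTerm k E n) :
      SymRel swap (castOp (arity_comp_one n) (.comp (fun _ : Fin n => 1) t (fun _ => .one))) t
  | assoc {n : ℕ} (m : Fin n → ℕ) (l : ∀ i, Fin (m i) → ℕ) (r : SymTerm k E n)
      (s : ∀ i, SymTerm k E (m i)) (t : ∀ i a, SymTerm k E (l i a)) :
      SymRel swap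
        (castOp (arity_assoc m l) (.comp _ r (fun i => .comp (l i) (s i) (t i))))
        (.comp (fun j => l (finSigmaFinEquiv.symm j).1 (finSigmaFinEquiv.symm j).2) (.comp m r s)
          (fun j => t (finSigmaFinEquiv.symm j).1 (finSigmaFinEquiv.symm j).2))
  | relabel_congr {a b : ℕ} (σ : Fin a ≃ Fin b) {t t' : SymTerm k E a} : SymRel swap t t' →
      SymRel swap (.relabel σ t) (.relabel σ t')
  | relabel_add {a b : ℕ} (σ : Fin a ≃ Fin b) (s t : SymTerm k E a) :
      SymRel swap (.relabel σ (.add s t)) (.add (.relabel σ s) (.relabel σ t))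
  | relabel_smul {a b : ℕ} (σ : Fin a ≃ Fin b) (c : k) (t : SymTerm k E a) :
      SymRel swap (.relabel σ (.smul c t)) (.smul c (.relabel σ t))
  | relabel_refl {n : ℕ} (t : SymTerm k E n) :
      SymRel swap (.relabel (Equiv.refl (Fin n)) t) t
  | relabel_trans {a b c : ℕ} (σ : Fin a ≃ Fin b) (τ : Fin b ≃ Fin c) (t : SymTerm k E a) :
      SymRel swap (.relabel τ (.relabel σ t)) (.relabel (σ.trans τ) t)
  | comp_relabel {n : ℕ} (m m' : Fin n → ℕ) (τ : ∀ i, Fin (m i) ≃ Fin (m' i))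
      (t : SymTerm k E n) (s : ∀ i, SymTerm k E (m i)) :
      SymRel swap (.comp m' t (fun i => .relabel (τ i) (s i)))
        (.relabel (sumEquiv τ) (.comp m t s))
  | relabel_comp {n n' : ℕ} (σ : Fin n ≃ Fin n') (m : Fin n' → ℕ) (t : SymTerm k E n)
      (s : ∀ i, SymTerm k E (m i)) :
      SymRel swap (.comp m (.relabel σ t) s)
        (.relabel (blockEquiv σ m) (.comp (fun i => m (σ i)) t (fun i => s (σ i))))
  | gen_swap (e : E) :
      SymRel swap (.relabel (Equiv.swap 0 1) (.gen e)) (.gen (swap e))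

namespace SymOperad

section Free

variable {k : Type u} [Field k] {E : Type v} [AddCommGroup E] [Module k E] (swap : E →ₗ[k] E)

/-- Formal expressions of arity `n` modulo the operad axioms. -/
def freeSetoid (n : ℕ) : Setoid (SymTerm k E n) :=
  ⟨SymRel swap, .refl, .symm, .trans⟩

/-- The component of arity `n` of the free symmetric operad. -/
def FreeObj (n : ℕ) : Type (max u v) :=
  Quotient (freeSetoid swap n)

/-- The class of a formal expression. -/
def FreeObj.mk (n : ℕ) (t : SymTerm k E n) : FreeObj swap n :=
  Quotient.mk (freeSetoid swap n) t

variable {swap}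

theorem FreeObj.ind {n : ℕ} {p : FreeObj swap n → Prop} (h : ∀ t, p (FreeObj.mk swap n t))
    (x : FreeObj swap n) : p x :=
  Quotient.ind h x

theorem FreeObj.sound {n : ℕ} {s t : SymTerm k E n} (h : SymRel swap s t) :
    FreeObj.mk swap n s = FreeObj.mk swap n t :=
  Quotient.sound h

instance FreeObj.instZero (n : ℕ) : Zero (FreeObj swap n) :=
  ⟨FreeObj.mk swap n (.zero n)⟩

instance FreeObj.instAdd (n : ℕ) : Add (FreeObj swap n) :=
  ⟨Quotient.map₂ SymTerm.add (fun _ _ h _ _ h' => SymRel.add_congr h h')⟩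

instance FreeObj.instNeg (n : ℕ) : Neg (FreeObj swap n) :=
  ⟨Quotient.map (SymTerm.smul (-1)) (fun _ _ h => SymRel.smul_congr _ h)⟩

instance FreeObj.instSMul (n : ℕ) : SMul k (FreeObj swap n) :=
  ⟨fun c => Quotient.map (SymTerm.smul c) (fun _ _ h => SymRel.smul_congr _ h)⟩

instance FreeObj.instAddCommGroup (n : ℕ) : AddCommGroup (FreeObj swap n) where
  add_assoc := FreeObj.ind fun r => FreeObj.ind fun s => FreeObj.ind fun t =>
    FreeObj.sound (SymRel.add_assoc r s t)
  add_comm := FreeObj.ind fun r => FreeObj.ind fun s => FreeObj.sound (SymRel.add_comm r s)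
  zero_add := FreeObj.ind fun t => FreeObj.sound (SymRel.zero_add t)
  add_zero := FreeObj.ind fun t =>
    FreeObj.sound ((SymRel.add_comm t _).trans (SymRel.zero_add t))
  neg_add_cancel := FreeObj.ind fun t => FreeObj.sound <| by
    have h := SymRel.add_smul (swap := swap) (-1 : k) 1 t
    rw [neg_add_cancel] at h
    exact ((SymRel.add_congr (.refl _) (SymRel.one_smul t).symm).trans h.symm).trans
      (SymRel.zero_smul t)
  nsmul := nsmulRec
  zsmul := zsmulRec

instance FreeObj.instModule (n : ℕ) : Module k (FreeObj swap n) where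
  one_smul := FreeObj.ind fun t => FreeObj.sound (SymRel.one_smul t)
  mul_smul c d := FreeObj.ind fun t => FreeObj.sound (SymRel.mul_smul c d t)
  smul_zero c := FreeObj.sound <| by
    have h := SymRel.mul_smul (swap := swap) c 0 (SymTerm.zero (k := k) (E := E) n)
    rw [mul_zero] at h
    exact (SymRel.smul_congr c (SymRel.zero_smul _).symm).trans (h.symm.trans (SymRel.zero_smul _))
  smul_add c := FreeObj.ind fun s => FreeObj.ind fun t => FreeObj.sound (SymRel.smul_add c s t)
  add_smul c d := FreeObj.ind fun t => FreeObj.sound (SymRel.add_smul c d t)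
  zero_smul := FreeObj.ind fun t => FreeObj.sound (SymRel.zero_smul t)

/-- Composition of classes, computed on representatives. -/
def FreeObj.comp {n : ℕ} (m : Fin n → ℕ) (x : FreeObj swap n) (y : ∀ i, FreeObj swap (m i)) :
    FreeObj swap (∑ i, m i) :=
  FreeObj.mk swap _ (.comp m (Quotient.out x) (fun i => Quotient.out (y i)))

theorem FreeObj.comp_mk {n : ℕ} (m : Fin n → ℕ) (t : SymTerm k E n)
    (s : ∀ i, SymTerm k E (m i)) :
    FreeObj.comp m (FreeObj.mk swap n t) (fun i => FreeObj.mk swap (m i) (s i)) =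
      FreeObj.mk swap _ (.comp m t s) :=
  FreeObj.sound (SymRel.comp_congr m (Quotient.mk_out (s := freeSetoid swap n) t)
    (fun i => Quotient.mk_out (s := freeSetoid swap (m i)) (s i)))

theorem FreeObj.exists_rep {ι : Type*} (m : ι → ℕ) (y : ∀ i, FreeObj swap (m i)) :
    ∃ s : ∀ i, SymTerm k E (m i), y = fun i => FreeObj.mk swap (m i) (s i) :=
  ⟨fun i => Quotient.out (y i), funext fun i => (Quotient.out_eq (y i)).symm⟩

theorem FreeObj.update_mk {n : ℕ} (m : Fin n → ℕ) (s : ∀ i, SymTerm k E (m i)) (i : Fin n)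
    (a : SymTerm k E (m i)) :
    Function.update (fun i => FreeObj.mk swap (m i) (s i)) i (FreeObj.mk swap (m i) a) =
      fun j => FreeObj.mk swap (m j) (Function.update s i a j) :=
  funext fun j => (Function.apply_update (fun i => FreeObj.mk swap (m i)) s i a j).symm

/-- Relabeling of the inputs of a class. -/
def FreeObj.relabel {a b : ℕ} (σ : Fin a ≃ Fin b) : FreeObj swap a →ₗ[k] FreeObj swap b where
  toFun := Quotient.map (SymTerm.relabel σ) (fun _ _ h => SymRel.relabel_congr σ h)
  map_add' := FreeObj.ind fun s => FreeObj.ind fun t => FreeObj.sound (SymRel.relabel_add σ s t)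
  map_smul' c := FreeObj.ind fun t => FreeObj.sound (SymRel.relabel_smul σ c t)

theorem FreeObj.relabel_mk {a b : ℕ} (σ : Fin a ≃ Fin b) (t : SymTerm k E a) :
    FreeObj.relabel σ (FreeObj.mk swap a t) = FreeObj.mk swap b (.relabel σ t) :=
  rfl

variable (swap)

/-- The free symmetric operad on the space `E` of binary generators with the action `swap` of the
transposition. -/
def free : SymOperad.{u, max u v} k where
  obj := FreeObj swap
  one := FreeObj.mk swap 1 .one
  comp m x y := FreeObj.comp m x y
  add_comp {n} m x x' y := by
    induction x using FreeObj.ind with | _ x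
    induction x' using FreeObj.ind with | _ x'
    obtain ⟨y, rfl⟩ := FreeObj.exists_rep m y
    change FreeObj.comp m (FreeObj.mk swap n (.add x x')) _ = _
    rw [FreeObj.comp_mk, FreeObj.comp_mk, FreeObj.comp_mk]
    exact FreeObj.sound (SymRel.add_comp m x x' y)
  smul_comp {n} m c x y := by
    induction x using FreeObj.ind with | _ x
    obtain ⟨y, rfl⟩ := FreeObj.exists_rep m y
    change FreeObj.comp m (FreeObj.mk swap n (.smul c x)) _ = _
    rw [FreeObj.comp_mk, FreeObj.comp_mk]
    exact FreeObj.sound (SymRel.smul_comp m c x y)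
  comp_add {n} m x y i a b := by
    induction x using FreeObj.ind with | _ x
    obtain ⟨y, rfl⟩ := FreeObj.exists_rep m y
    induction a using FreeObj.ind with | _ a
    induction b using FreeObj.ind with | _ b
    change FreeObj.comp m _ (Function.update _ i (FreeObj.mk swap _ (.add a b))) = _
    rw [FreeObj.update_mk, FreeObj.update_mk, FreeObj.update_mk, FreeObj.comp_mk,
      FreeObj.comp_mk, FreeObj.comp_mk]
    exact FreeObj.sound (SymRel.comp_add m x y i a b)
  comp_smul {n} m x y i c a := by
    induction x using FreeObj.ind with | _ x
    obtain ⟨y, rfl⟩ := FreeObj.exists_rep m y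
    induction a using FreeObj.ind with | _ a
    change FreeObj.comp m _ (Function.update _ i (FreeObj.mk swap _ (.smul c a))) = _
    rw [FreeObj.update_mk, FreeObj.update_mk, FreeObj.comp_mk, FreeObj.comp_mk]
    exact FreeObj.sound (SymRel.comp_smul m x y i c a)
  one_comp {n} x := by
    induction x using FreeObj.ind with | _ x
    rw [FreeObj.comp_mk, ← map_castOp (FreeObj.mk swap)]
    exact FreeObj.sound (SymRel.one_comp x)
  comp_one {n} x := by
    induction x using FreeObj.ind with | _ x
    rw [FreeObj.comp_mk, ← map_castOp (FreeObj.mk swap)]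
    exact FreeObj.sound (SymRel.comp_one x)
  assoc {n} m l x y z := by
    induction x using FreeObj.ind with | _ x
    obtain ⟨y, rfl⟩ := FreeObj.exists_rep m y
    choose z' hz' using fun i => FreeObj.exists_rep (l i) (z i)
    obtain rfl : z = fun i a => FreeObj.mk swap _ (z' i a) := funext hz'
    simp only [FreeObj.comp_mk]
    rw [← map_castOp (FreeObj.mk swap)]
    exact FreeObj.sound (SymRel.assoc m l x y z')
  relabel σ := FreeObj.relabel σ
  relabel_refl := FreeObj.ind fun t => FreeObj.sound (SymRel.relabel_refl t)
  relabel_trans σ τ := FreeObj.ind fun t => FreeObj.sound (SymRel.relabel_trans σ τ t)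
  comp_relabel {n} m m' τ x y := by
    induction x using FreeObj.ind with | _ x
    obtain ⟨y, rfl⟩ := FreeObj.exists_rep m y
    simp only [FreeObj.relabel_mk, FreeObj.comp_mk]
    exact FreeObj.sound (SymRel.comp_relabel m m' τ x y)
  relabel_comp {n n'} σ m x y := by
    induction x using FreeObj.ind with | _ x
    obtain ⟨y, rfl⟩ := FreeObj.exists_rep m y
    simp only [FreeObj.relabel_mk, FreeObj.comp_mk]
    exact FreeObj.sound (SymRel.relabel_comp σ m x y)

/-- The inclusion of the generators. -/
def freeGen : E →ₗ[k] (free swap).obj 2 where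
  toFun e := FreeObj.mk swap 2 (.gen e)
  map_add' e f := FreeObj.sound (SymRel.gen_add e f)
  map_smul' c e := FreeObj.sound (SymRel.gen_smul c e)

end Free

end SymOperad

/-! ### Binary quadratic symmetric operads -/

/-- The space `T(E)(3)` of quadratic ternary elements of the free symmetric operad on `E`. With
inputs `x₀, x₁, x₂` and indices modulo `3`, the element `a ⊗ b` in component `u` stands for
`(x_u a x_{u+1}) b x_{u+2}`. -/
abbrev SymQuad (k : Type u) [Field k] (E : Type v) [AddCommGroup E] [Module k E] :
    Type v :=
  Fin 3 → E ⊗[k] E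

namespace SymQuad

variable {k : Type u} [Field k] {E : Type v} [AddCommGroup E] [Module k E]

/-- The action of a cyclic permutation of the three inputs. -/
def cyc : SymQuad k E →ₗ[k] SymQuad k E :=
  LinearMap.funLeft k (E ⊗[k] E) (fun u : Fin 3 => u + 1)

/-- The action of the transposition of the inputs `x₀` and `x₁`. -/
def flip (swap : E →ₗ[k] E) : SymQuad k E →ₗ[k] SymQuad k E :=
  LinearMap.compLeft (TensorProduct.map swap LinearMap.id) (Fin 3) ∘ₗ
    LinearMap.funLeft k (E ⊗[k] E) (fun u : Fin 3 => -u)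

/-- Stability under the action of the symmetric group on the three inputs. -/
def IsStable (swap : E →ₗ[k] E) (R : Submodule k (SymQuad k E)) : Prop :=
  (∀ t ∈ R, cyc t ∈ R) ∧ ∀ t ∈ R, flip swap t ∈ R

/-- The smallest stable subspace containing `S`. -/
def stableSpan (swap : E →ₗ[k] E) (S : Set (SymQuad k E)) : Submodule k (SymQuad k E) :=
  sInf {R | S ⊆ R ∧ IsStable swap R}

theorem isStable_stableSpan (swap : E →ₗ[k] E) (S : Set (SymQuad k E)) :
    IsStable swap (stableSpan swap S) := by
  constructor <;> intro t ht <;> simp only [stableSpan, Submodule.mem_sInf] at ht ⊢ <;>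
    intro R hR
  · exact hR.2.1 t (ht R hR)
  · exact hR.2.2 t (ht R hR)

/-- The element `(x_u a x_{u+1}) b x_{u+2}`. -/
def tree (u : Fin 3) (a b : E) : SymQuad k E :=
  Pi.single u (a ⊗ₜ[k] b)

/-- The pairing of `T(E^∨)(3)` with `T(E)(3)`. -/
def pairing (x : SymQuad k (Module.Dual k E)) (r : SymQuad k E) : k :=
  ∑ u, TensorProduct.dualDistrib k E E (x u) (r u)

theorem pairing_cyc (x : SymQuad k (Module.Dual k E)) (r : SymQuad k E) :
    pairing (cyc x) r = pairing x (cyc (cyc r)) := by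
  simp only [pairing, cyc, LinearMap.funLeft_apply]
  exact Fintype.sum_equiv (Equiv.addRight (1 : Fin 3)) _ _ (fun u => by
    have h : u + 1 + 1 + 1 = u := by revert u; decide
    simp [h])

theorem dualDistrib_swap (swap : E →ₗ[k] E) (x : Module.Dual k E ⊗[k] Module.Dual k E)
    (r : E ⊗[k] E) :
    TensorProduct.dualDistrib k E E
        (TensorProduct.map (-Module.Dual.transpose (R := k) swap) LinearMap.id x) r =
      -TensorProduct.dualDistrib k E E x (TensorProduct.map swap LinearMap.id r) := by
  induction x using TensorProduct.induction_on with
  | zero => simp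
  | add x y hx hy =>
    simp only [map_add, LinearMap.add_apply, hx, hy]
    ring
  | tmul f g =>
    induction r using TensorProduct.induction_on with
    | zero => simp
    | add r s hr hs =>
      simp only [map_add, hr, hs]
      ring
    | tmul a b => simp [Module.Dual.transpose_apply]

theorem pairing_flip (swap : E →ₗ[k] E) (x : SymQuad k (Module.Dual k E)) (r : SymQuad k E) :
    pairing (flip (-Module.Dual.transpose (R := k) swap) x) r = -pairing x (flip swap r) := by
  simp only [pairing, flip, LinearMap.comp_apply, LinearMap.compLeft_apply, Function.comp_apply,
    LinearMap.funLeft_apply, dualDistrib_swap, Finset.sum_neg_distrib]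
  exact congrArg Neg.neg (Fintype.sum_equiv (Equiv.neg (Fin 3)) _ _ (fun u => by simp))

end SymQuad

/-- Binary quadratic data: a space `E` of binary operations with the action `swap` of the
transposition (`x (swap e) y = y e x`), and a subspace `R` of `T(E)(3)` that is stable under the
symmetric group. -/
structure SymQuadData (k : Type u) [Field k] where
  E : Type v
  [addCommGroup : AddCommGroup E]
  [module : Module k E]
  swap : E →ₗ[k] E
  swap_swap : ∀ e, swap (swap e) = e
  R : Submodule k (SymQuad k E)
  stable : SymQuad.IsStable swap R

namespace SymQuadData

attribute [instance] SymQuadData.addCommGroup SymQuadData.module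

variable {k : Type u} [Field k]

/-- The realization of quadratic elements as ternary operations of the free operad. -/
def realize (D : SymQuadData.{u, v} k) :
    SymQuad k D.E →ₗ[k] (SymOperad.free D.swap).obj 3 :=
  let T := SymOperad.free D.swap
  let g := SymOperad.freeGen D.swap
  ∑ u : Fin 3, T.relabel (Equiv.addRight u) ∘ₗ
    TensorProduct.lift (T.leftComb.compl₁₂ g g) ∘ₗ LinearMap.proj u

/-- The operad `P(E, R) = T(E) / ⟨R⟩`. -/
def operad (D : SymQuadData.{u, v} k) : SymOperad.{u, max u v} k :=
  (SymOperad.free D.swap).quotient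
    ((SymOperad.free D.swap).idealSpan ((fun r => ⟨3, D.realize r⟩) '' (D.R : Set _)))

/-- The quadratic data `(E^∨, R^⊥)` of the Koszul dual operad (for finite dimensional `E`), where
`E^∨` is the linear dual of `E` twisted by the sign representation. -/
def koszulDual (D : SymQuadData.{u, v} k) : SymQuadData.{u, max u v} k where
  E := Module.Dual k D.E
  swap := -Module.Dual.transpose (R := k) D.swap
  swap_swap f := by
    ext e
    simp [Module.Dual.transpose_apply, D.swap_swap]
  R :=
    { carrier := {x | ∀ r ∈ D.R, SymQuad.pairing x r = 0}
      zero_mem' := by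
        intro r _
        simp [SymQuad.pairing]
      add_mem' := by
        intro x y hx hy r hr
        have h : SymQuad.pairing (x + y) r = SymQuad.pairing x r + SymQuad.pairing y r := by
          simp [SymQuad.pairing, Finset.sum_add_distrib]
        rw [h, hx r hr, hy r hr, add_zero]
      smul_mem' := by
        intro c x hx r hr
        have h : SymQuad.pairing (c • x) r = c * SymQuad.pairing x r := by
          simp [SymQuad.pairing, Finset.mul_sum]
        rw [h, hx r hr, mul_zero] }
  stable := by
    constructor
    · intro x hx r hr
      rw [SymQuad.pairing_cyc]
      exact hx _ (D.stable.1 _ (D.stable.1 _ hr))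
    · intro x hx r hr
      rw [SymQuad.pairing_flip, hx _ (D.stable.2 _ hr), neg_zero]

/-- An operad is Koszul self-dual if it is isomorphic to its Koszul dual operad. -/
def IsKoszulSelfDual (D : SymQuadData.{u, v} k) : Prop :=
  Nonempty (D.koszulDual.operad.Iso D.operad)

/-- The action of the transposition on `Ω` copies of `E`. -/
def copiesSwap (Ω : Type w) {E : Type v} [AddCommGroup E] [Module k E] (swap : E →ₗ[k] E) :
    (Ω →₀ E) →ₗ[k] (Ω →₀ E) :=
  Finsupp.mapRange.linearMap swap

theorem copiesSwap_copiesSwap (Ω : Type w) {E : Type v} [AddCommGroup E] [Module k E]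
    (swap : E →ₗ[k] E) (h : ∀ e, swap (swap e) = e) (x : Ω →₀ E) :
    copiesSwap Ω swap (copiesSwap Ω swap x) = x := by
  ext ω
  simp [copiesSwap, h]

/-- The quadratic data of the matching operad: one copy of the generators for each `ω ∈ Ω`, and for
all `μ, ν ∈ Ω` the relations `R^{μ,ν}`, obtained from those of `R` by replacing each
`(x_u a x_{u+1}) b x_{u+2}` by `(x_u a_μ x_{u+1}) b_ν x_{u+2}`. -/
def matching (Ω : Type w) (D : SymQuadData.{u, v} k) : SymQuadData.{u, max v w} k where
  E := Ω →₀ D.E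
  swap := copiesSwap Ω D.swap
  swap_swap := copiesSwap_copiesSwap Ω D.swap D.swap_swap
  R := SymQuad.stableSpan (copiesSwap Ω D.swap)
    {t | ∃ (μ ν : Ω), ∃ r ∈ D.R, t = fun u =>
      TensorProduct.map (Finsupp.lsingle (R := k) μ) (Finsupp.lsingle (R := k) ν) (r u)}
  stable := SymQuad.isStable_stableSpan _ _

variable (k) in
/-- The space spanned by a symmetric product `(1, 0)` and an antisymmetric bracket `(0, 1)`, with
the action of the transposition. -/
def poissonSwap : (k × k) →ₗ[k] (k × k) :=
  LinearMap.prodMap LinearMap.id (-LinearMap.id)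

theorem poissonSwap_poissonSwap (e : k × k) : poissonSwap k (poissonSwap k e) = e := by
  simp [poissonSwap]

variable (k) in
/-- Poisson algebras: a commutative product `c` and a Lie bracket `l`, with the associativity
`(x₀ x₁) x₂ = (x₁ x₂) x₀`, the Jacobi identity, and the Leibniz rule
`{x₀ x₁, x₂} = {x₁, x₂} x₀ - {x₂, x₀} x₁`. -/
def poisson : SymQuadData.{u, u} k where
  E := k × k
  swap := poissonSwap k
  swap_swap := poissonSwap_poissonSwap
  R :=
    let c : k × k := (1, 0)
    let l : k × k := (0, 1)
    SymQuad.stableSpan (poissonSwap k)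
      {SymQuad.tree 0 c c - SymQuad.tree 1 c c,
       SymQuad.tree 0 l l + SymQuad.tree 1 l l + SymQuad.tree 2 l l,
       SymQuad.tree 0 c l - SymQuad.tree 1 l c + SymQuad.tree 2 l c}
  stable := SymQuad.isStable_stableSpan _ _

variable (k) in
/-- The variant of matching Poisson algebras in which the labels in the Leibniz rule are attached to
the product and to the bracket: with products `c μ` and brackets `l μ`, for all `μ, ν ∈ Ω`,
`(x₀ c_μ x₁) c_ν x₂ = (x₁ c_μ x₂) c_ν x₀`, the sum of the cyclic permutations of
`(x₀ l_μ x₁) l_ν x₂` vanishes, and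
`(x₀ c_μ x₁) l_ν x₂ = (x₁ l_ν x₂) c_μ x₀ - (x₂ l_ν x₀) c_μ x₁`. -/
def matchingPoissonByKind (Ω : Type w) : SymQuadData.{u, max u w} k where
  E := Ω →₀ k × k
  swap := copiesSwap Ω (poissonSwap k)
  swap_swap := copiesSwap_copiesSwap Ω _ poissonSwap_poissonSwap
  R :=
    let c : Ω → Ω →₀ k × k := fun ω => Finsupp.single ω (1, 0)
    let l : Ω → Ω →₀ k × k := fun ω => Finsupp.single ω (0, 1)
    SymQuad.stableSpan (copiesSwap Ω (poissonSwap k))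
      {t | ∃ μ ν : Ω,
        t = SymQuad.tree 0 (c μ) (c ν) - SymQuad.tree 1 (c μ) (c ν) ∨
        t = SymQuad.tree 0 (l μ) (l ν) + SymQuad.tree 1 (l μ) (l ν) +
          SymQuad.tree 2 (l μ) (l ν) ∨
        t = SymQuad.tree 0 (c μ) (l ν) - SymQuad.tree 1 (l ν) (c μ) +
          SymQuad.tree 2 (l ν) (c μ)}
  stable := SymQuad.isStable_stableSpan _ _

end SymQuadData

end

/-! Self-duality is a statement about quadratic relations only. A linear isomorphism of generators,
equivariant in the symmetric case, extends to the free operads; if it carries one space of relations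
onto the other, it carries the generated ideals onto each other and descends to the quotients (the
two `nonempty_iso`). It remains to find `φ : E* ≃ E` such that `φ ⊗ φ` carries `R^⊥` onto `R`.

Associative case: since the `b μ ⊗ b ν` span `E ⊗ E`, the matching relations fill the whole
antidiagonal `{(t, -t)}`. With signs `+` and `-` on the two summands, `x` pairs with `(t, -t)` to
`(x.1 + x.2)(t)`, so `R^⊥` is again the antidiagonal, and the identification of `E*` with `E`
through a basis carries one onto the other.

Poisson case: let `c_ω`, `l_ω` be the basis of products and brackets, and let `φ` send `c_ω*` to
`l_ω` and `l_ω*` to `c_ω`. The sign twist makes `c_ω*` antisymmetric and `l_ω*` symmetric, so `φ` is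
equivariant. The space `R` has two descriptions: it is the stable span of associativity, Jacobi and
Leibniz, and it is cut out by linear equations on coordinates (`poissonRel`). For each pair of
labels the three coordinates of type `cc` sum to zero, those of type `ll` are equal, and those of
type `lc` are differences of those of type `cl`. Under `φ`, orthogonality to associativity becomes
the `ll` equations, orthogonality to Jacobi becomes the `cc` equation, and orthogonality to Leibniz
becomes the mixed equations (`forall_pairing_eq_zero_iff`).

Both versions of the Leibniz rule are treated together: `s` is the permutation of label pairs from
the left hand side to the right hand side. Dualizing replaces `s` by its inverse, so self-duality
needs `s` to be an involution. It is the identity for the matching operad and the exchange of `μ`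
and `ν` when labels follow the kind of operation. -/

noncomputable section

/-! ### Ideals and isomorphisms -/

namespace OpCore

variable {k : Type u} [Field k]

/-- The preimage of an ideal under a family of linear maps that preserves composition. -/
def OpIdeal.comap {P : OpCore.{u, v} k} {Q : OpCore.{u, w} k} (f : ∀ n, P.obj n →ₗ[k] Q.obj n)
    (hf : ∀ {n : ℕ} (m : Fin n → ℕ) (x : P.obj n) (y : ∀ i, P.obj (m i)),
      f _ (P.comp m x y) = Q.comp m (f n x) (fun i => f (m i) (y i)))
    (J : OpIdeal Q) : OpIdeal P where
  carrier n := (J.carrier n).comap (f n)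
  comp_mem_left m x y hx := by
    simp only [Submodule.mem_comap, hf] at hx ⊢
    exact J.comp_mem_left m _ _ hx
  comp_mem_right m x y i hy := by
    simp only [Submodule.mem_comap, hf] at hy ⊢
    exact J.comp_mem_right m _ _ i hy

theorem map_opPair {F : ℕ → Type v} {G : ℕ → Type w} (f : ∀ n, F n → G n) {a b : ℕ}
    (x : F a) (y : F b) : (fun i => f _ (opPair x y i)) = opPair (f a x) (f b y) := by
  funext i
  fin_cases i <;> rfl

end OpCore

namespace NSOperad

variable {k : Type u} [Field k]

/-- The inverse of an isomorphism. -/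
def Iso.symm {P : NSOperad.{u, v} k} {Q : NSOperad.{u, w} k} (f : P.Iso Q) : Q.Iso P where
  toEquiv n := (f.toEquiv n).symm
  map_one := by rw [LinearEquiv.symm_apply_eq, f.map_one]
  map_comp m x y := by
    rw [LinearEquiv.symm_apply_eq, f.map_comp]
    simp

theorem Iso.map_leftComb {P : NSOperad.{u, v} k} {Q : NSOperad.{u, w} k} (f : P.Iso Q)
    (x y : P.obj 2) : f.toEquiv 3 (P.leftComb x y) =
      Q.leftComb (f.toEquiv 2 x) (f.toEquiv 2 y) := by
  change f.toEquiv 3 (castOp (arity_two 2 1) (P.comp ![2, 1] y (opPair x P.one))) =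
    castOp (arity_two 2 1) (Q.comp ![2, 1] (f.toEquiv 2 y) (opPair (f.toEquiv 2 x) Q.one))
  rw [map_castOp (fun n => f.toEquiv n), f.map_comp,
    OpCore.map_opPair (fun n => f.toEquiv n), f.map_one]

theorem Iso.map_rightComb {P : NSOperad.{u, v} k} {Q : NSOperad.{u, w} k} (f : P.Iso Q)
    (x y : P.obj 2) : f.toEquiv 3 (P.rightComb x y) =
      Q.rightComb (f.toEquiv 2 x) (f.toEquiv 2 y) := by
  change f.toEquiv 3 (castOp (arity_two 1 2) (P.comp ![1, 2] x (opPair P.one y))) =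
    castOp (arity_two 1 2) (Q.comp ![1, 2] (f.toEquiv 2 x) (opPair Q.one (f.toEquiv 2 y)))
  rw [map_castOp (fun n => f.toEquiv n), f.map_comp,
    OpCore.map_opPair (fun n => f.toEquiv n), f.map_one]

theorem subset_idealSpan (P : NSOperad.{u, v} k) (S : Set (Σ n, P.obj n)) (p : Σ n, P.obj n)
    (hp : p ∈ S) : p.2 ∈ (P.idealSpan S).carrier p.1 := by
  change _ ∈ ⨅ (I : P.toOpCore.OpIdeal) (_ : ∀ p ∈ S, p.2 ∈ I.carrier p.1), I.carrier p.1
  simp only [Submodule.mem_iInf]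
  exact fun I hI => hI p hp

/-- The preimage of the ideal generated by `T` is an ideal containing `S`, hence contains the
smallest one. Applied to an isomorphism and to its inverse, this identifies generated ideals. -/
theorem Iso.idealSpan_le {P : NSOperad.{u, v} k} {Q : NSOperad.{u, w} k} (f : P.Iso Q)
    (S : Set (Σ n, P.obj n)) (T : Set (Σ n, Q.obj n))
    (h : ∀ p ∈ S, (⟨p.1, f.toEquiv p.1 p.2⟩ : Σ n, Q.obj n) ∈ T) (n : ℕ) :
    (P.idealSpan S).carrier n ≤ ((Q.idealSpan T).carrier n).comap (f.toEquiv n).toLinearMap := by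
  let J : P.toOpCore.OpIdeal :=
    (Q.idealSpan T).comap (fun n => (f.toEquiv n).toLinearMap) f.map_comp
  exact iInf₂_le (f := fun (I : P.toOpCore.OpIdeal) (_ : ∀ p ∈ S, p.2 ∈ I.carrier p.1) =>
    I.carrier n) J (fun p hp => Q.subset_idealSpan T _ (h p hp))

/-- An isomorphism that carries an ideal onto another one descends to the quotients. -/
def Iso.quotient {P : NSOperad.{u, v} k} {Q : NSOperad.{u, w} k} (f : P.Iso Q)
    (I : P.toOpCore.OpIdeal) (J : Q.toOpCore.OpIdeal)
    (h : ∀ n, (I.carrier n).map (f.toEquiv n).toLinearMap = J.carrier n) :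
    (P.quotient I).Iso (Q.quotient J) where
  toEquiv n := Submodule.Quotient.equiv (I.carrier n) (J.carrier n) (f.toEquiv n) (h n)
  map_one := congrArg (J.toQuot 1) f.map_one
  map_comp {n} m x y := by
    obtain ⟨x, rfl⟩ := I.toQuot_surjective _ x
    obtain ⟨y, rfl⟩ := I.exists_rep m y
    change Submodule.Quotient.equiv _ _ _ _ (I.quotComp m _ _) =
      J.quotComp m (J.toQuot _ (f.toEquiv n x)) (fun i => J.toQuot _ (f.toEquiv (m i) (y i)))
    rw [I.quotComp_mk, J.quotComp_mk, ← f.map_comp]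
    rfl

end NSOperad

/-! ### Functoriality of free nonsymmetric operads -/

namespace NSTerm

/-- Substitution of generators in a formal expression. -/
def map {k : Type u} {E : Type v} {F : Type w} (φ : E → F) : ∀ {n : ℕ}, NSTerm k E n → NSTerm k F n
  | _, .gen e => .gen (φ e)
  | _, .one => .one
  | _, .zero n => .zero n
  | _, .add s t => .add (map φ s) (map φ t)
  | _, .smul c t => .smul c (map φ t)
  | _, .comp m t s => .comp m (map φ t) (fun i => map φ (s i))

theorem map_map_of_leftInverse {k : Type u} {E : Type v} {F : Type w} {φ : E → F} {ψ : F → E}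
    (h : Function.LeftInverse ψ φ) {n : ℕ} (t : NSTerm k E n) : (t.map φ).map ψ = t := by
  induction t with
  | gen e => simp only [map, h e]
  | one => rfl
  | zero n => rfl
  | add s t hs ht => simp only [map, hs, ht]
  | smul c t ht => simp only [map, ht]
  | comp m t s ht hs => simp only [map, ht, hs]

end NSTerm

section NSFree

variable {k : Type u} [Field k] {E : Type v} [AddCommGroup E] [Module k E]
  {F : Type w} [AddCommGroup F] [Module k F]

/-- Every rule of the congruence is a scheme closed under substitution of generators; linearity of
`φ` enters only in `gen_add` and `gen_smul`. -/
theorem NSRel.map (φ : E →ₗ[k] F) {n : ℕ} {s t : NSTerm k E n} (h : NSRel k E s t) :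
    NSRel k F (s.map φ) (t.map φ) := by
  -- Substitution commutes with changing a single argument, as the multilinearity rules in the upper
  -- slots require.
  have hu : ∀ {n : ℕ} (m : Fin n → ℕ) (s : ∀ i, NSTerm k E (m i)) (i : Fin n)
      (a : NSTerm k E (m i)), (fun j => (Function.update s i a j).map φ) =
      Function.update (fun j => (s j).map φ) i (a.map φ) := fun m s i a =>
    funext fun j => Function.apply_update (fun _ => NSTerm.map φ) s i a j
  induction h with
  | refl t => exact .refl _
  | symm _ ih => exact ih.symm
  | trans _ _ ih ih' => exact ih.trans ih'
  | add_congr _ _ ih ih' => exact .add_congr ih ih'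
  | smul_congr c _ ih => exact .smul_congr c ih
  | comp_congr m _ _ ih ih' => exact .comp_congr m ih ih'
  | add_assoc r s t => exact .add_assoc _ _ _
  | add_comm s t => exact .add_comm _ _
  | zero_add t => exact .zero_add _
  | one_smul t => exact .one_smul _
  | zero_smul t => exact .zero_smul _
  | mul_smul c d t => exact .mul_smul c d _
  | add_smul c d t => exact .add_smul c d _
  | smul_add c s t => exact .smul_add c _ _
  | gen_add e f =>
    simp only [NSTerm.map, map_add]
    exact .gen_add _ _
  | gen_smul c e =>
    simp only [NSTerm.map, map_smul]
    exact .gen_smul c _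
  | add_comp m t t' s => exact .add_comp m _ _ _
  | smul_comp m c t s => exact .smul_comp m c _ _
  | comp_add m t s i a b =>
    simp only [NSTerm.map, hu]
    exact .comp_add m _ _ i _ _
  | comp_smul m t s i c a =>
    simp only [NSTerm.map, hu]
    exact .comp_smul m _ _ i c _
  | one_comp t =>
    rw [map_castOp (fun n => NSTerm.map (n := n) φ)]
    exact .one_comp _
  | comp_one t =>
    rw [map_castOp (fun n => NSTerm.map (n := n) φ)]
    exact .comp_one _
  | assoc m l r s t =>
    rw [map_castOp (fun n => NSTerm.map (n := n) φ)]
    exact .assoc m l _ _ _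

namespace NSOperad

/-- The map of free operads induced by a linear map of generators. -/
def freeMap (φ : E →ₗ[k] F) (n : ℕ) : FreeObj k E n →ₗ[k] FreeObj k F n where
  toFun := Quotient.map (NSTerm.map φ) (fun _ _ h => NSRel.map φ h)
  map_add' := FreeObj.ind fun _ => FreeObj.ind fun _ => rfl
  map_smul' _ := FreeObj.ind fun _ => rfl

/-- The isomorphism of free operads induced by an isomorphism of generators. -/
def freeIso (φ : E ≃ₗ[k] F) : (free k E).Iso (free k F) where
  toEquiv n := LinearEquiv.ofLinearMap (freeMap φ.toLinearMap n) (freeMap φ.symm.toLinearMap n)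
    (LinearMap.ext <| FreeObj.ind fun t => congrArg (FreeObj.mk n)
      (NSTerm.map_map_of_leftInverse φ.apply_symm_apply t))
    (LinearMap.ext <| FreeObj.ind fun t => congrArg (FreeObj.mk n)
      (NSTerm.map_map_of_leftInverse φ.symm_apply_apply t))
  map_one := rfl
  map_comp {n} m x y := by
    induction x using FreeObj.ind with | _ x
    obtain ⟨y, rfl⟩ := FreeObj.exists_rep m y
    change freeMap _ _ (FreeObj.comp _ _ _) =
      FreeObj.comp m (FreeObj.mk n (x.map φ)) (fun i => FreeObj.mk (m i) ((y i).map φ))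
    rw [FreeObj.comp_mk, FreeObj.comp_mk]
    rfl

end NSOperad

end NSFree

/-! ### Isomorphisms of nonsymmetric quadratic data -/

namespace NSQuadData

variable {k : Type u} [Field k]

/-- Realization is natural in the generators, because an isomorphism of operads preserves left and
right combs; so a condition on `R` alone controls the generating set of the ideal. -/
theorem freeIso_realize (D : NSQuadData.{u, v} k) (D' : NSQuadData.{u, w} k)
    (φ : D.E ≃ₗ[k] D'.E) (r : (D.E ⊗[k] D.E) × (D.E ⊗[k] D.E)) :
    (NSOperad.freeIso φ).toEquiv 3 (D.realize r) =
      D'.realize ((TensorProduct.congr φ φ).prodCongr (TensorProduct.congr φ φ) r) := by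
  suffices h : ((NSOperad.freeIso φ).toEquiv 3).toLinearMap ∘ₗ D.realize =
      D'.realize ∘ₗ ((TensorProduct.congr φ φ).prodCongr (TensorProduct.congr φ φ)).toLinearMap from
    LinearMap.congr_fun h r
  refine LinearMap.prod_ext (TensorProduct.ext' fun a b => ?_) (TensorProduct.ext' fun a b => ?_)
  · simp [realize]
    exact (NSOperad.freeIso φ).map_leftComb _ _
  · simp [realize]
    exact (NSOperad.freeIso φ).map_rightComb _ _

/-- An isomorphism of quadratic data induces an isomorphism of operads. -/
theorem nonempty_iso (D : NSQuadData.{u, v} k) (D' : NSQuadData.{u, w} k) (φ : D.E ≃ₗ[k] D'.E)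
    (h : ∀ r, r ∈ D.R ↔
      (TensorProduct.congr φ φ).prodCongr (TensorProduct.congr φ φ) r ∈ D'.R) :
    Nonempty (D.operad.Iso D'.operad) := by
  refine ⟨(NSOperad.freeIso φ).quotient _ _ fun n => le_antisymm ?_ ?_⟩
  · rw [Submodule.map_le_iff_le_comap]
    refine (NSOperad.freeIso φ).idealSpan_le _ _ ?_ n
    rintro _ ⟨r, hr, rfl⟩
    exact ⟨_, (h r).1 hr, by rw [freeIso_realize]⟩
  -- The reverse inclusion is the same argument for the inverse isomorphism; each relation of `D'`
  -- is the image of a relation of `D` since `φ ⊗ φ` is bijective.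
  · rw [Submodule.map_equiv_eq_comap_symm]
    refine (NSOperad.freeIso φ).symm.idealSpan_le _ _ ?_ n
    rintro _ ⟨r, hr, rfl⟩
    obtain ⟨r, rfl⟩ := ((TensorProduct.congr φ φ).prodCongr (TensorProduct.congr φ φ)).surjective r
    refine ⟨r, (h r).2 hr, ?_⟩
    simp only [← freeIso_realize]
    exact congrArg (Sigma.mk 3) (LinearEquiv.symm_apply_apply _ _).symm

end NSQuadData

/-! ### Ideals and isomorphisms of symmetric operads -/

namespace SymOperad

variable {k : Type u} [Field k]

/-- The inverse of an isomorphism. -/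
def Iso.symm {P : SymOperad.{u, v} k} {Q : SymOperad.{u, w} k} (f : P.Iso Q) : Q.Iso P where
  toIso := f.toIso.symm
  map_relabel {a b} σ x := by
    change (f.toEquiv b).symm _ = P.relabel σ ((f.toEquiv a).symm x)
    rw [LinearEquiv.symm_apply_eq, f.map_relabel]
    simp

theorem subset_idealSpan (P : SymOperad.{u, v} k) (S : Set (Σ n, P.obj n)) (p : Σ n, P.obj n)
    (hp : p ∈ S) : p.2 ∈ (P.idealSpan S).carrier p.1 := by
  change _ ∈ ⨅ (I : P.SymIdeal) (_ : ∀ p ∈ S, p.2 ∈ I.carrier p.1), I.carrier p.1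
  simp only [Submodule.mem_iInf]
  exact fun I hI => hI p hp

theorem Iso.idealSpan_le {P : SymOperad.{u, v} k} {Q : SymOperad.{u, w} k} (f : P.Iso Q)
    (S : Set (Σ n, P.obj n)) (T : Set (Σ n, Q.obj n))
    (h : ∀ p ∈ S, (⟨p.1, f.toEquiv p.1 p.2⟩ : Σ n, Q.obj n) ∈ T) (n : ℕ) :
    (P.idealSpan S).carrier n ≤ ((Q.idealSpan T).carrier n).comap (f.toEquiv n).toLinearMap := by
  let J : P.SymIdeal :=
    { (Q.idealSpan T).toOpIdeal.comap (fun n => (f.toEquiv n).toLinearMap) f.map_comp with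
      relabel_mem := fun {a b} σ x hx => by
        change f.toEquiv b (P.relabel σ x) ∈ (Q.idealSpan T).carrier b
        rw [f.map_relabel]
        exact (Q.idealSpan T).relabel_mem σ _ hx }
  exact iInf₂_le (f := fun (I : P.SymIdeal) (_ : ∀ p ∈ S, p.2 ∈ I.carrier p.1) =>
    I.carrier n) J (fun p hp => Q.subset_idealSpan T _ (h p hp))

/-- An isomorphism that carries an ideal onto another one descends to the quotients. -/
def Iso.quotient {P : SymOperad.{u, v} k} {Q : SymOperad.{u, w} k} (f : P.Iso Q)
    (I : P.SymIdeal) (J : Q.SymIdeal)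
    (h : ∀ n, (I.carrier n).map (f.toEquiv n).toLinearMap = J.carrier n) :
    (P.quotient I).Iso (Q.quotient J) where
  toIso := f.toIso.quotient I.toOpIdeal J.toOpIdeal h
  map_relabel {a b} σ x := by
    obtain ⟨x, rfl⟩ := I.toQuot_surjective _ x
    exact congrArg (J.toQuot b) (f.map_relabel σ x)

end SymOperad

/-! ### Functoriality of free symmetric operads -/

namespace SymTerm

/-- Substitution of generators in a formal expression. -/
def map {k : Type u} {E : Type v} {F : Type w} (φ : E → F) :
    ∀ {n : ℕ}, SymTerm k E n → SymTerm k F n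
  | _, .gen e => .gen (φ e)
  | _, .one => .one
  | _, .zero n => .zero n
  | _, .add s t => .add (map φ s) (map φ t)
  | _, .smul c t => .smul c (map φ t)
  | _, .comp m t s => .comp m (map φ t) (fun i => map φ (s i))
  | _, .relabel σ t => .relabel σ (map φ t)

theorem map_map_of_leftInverse {k : Type u} {E : Type v} {F : Type w} {φ : E → F} {ψ : F → E}
    (h : Function.LeftInverse ψ φ) {n : ℕ} (t : SymTerm k E n) : (t.map φ).map ψ = t := by
  induction t with
  | gen e => simp only [map, h e]
  | one => rfl
  | zero n => rfl
  | add s t hs ht => simp only [map, hs, ht]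
  | smul c t ht => simp only [map, ht]
  | comp m t s ht hs => simp only [map, ht, hs]
  | relabel σ t ht => simp only [map, ht]

end SymTerm

section SymFree

variable {k : Type u} [Field k] {E : Type v} [AddCommGroup E] [Module k E]
  {F : Type w} [AddCommGroup F] [Module k F] {swap : E →ₗ[k] E} {swap' : F →ₗ[k] F}

/-- As in the nonsymmetric case; equivariance of `φ` is used only for the rule `gen_swap`. -/
theorem SymRel.map (φ : E →ₗ[k] F) (hφ : ∀ e, φ (swap e) = swap' (φ e)) {n : ℕ}
    {s t : SymTerm k E n} (h : SymRel swap s t) : SymRel swap' (s.map φ) (t.map φ) := by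
  have hu : ∀ {n : ℕ} (m : Fin n → ℕ) (s : ∀ i, SymTerm k E (m i)) (i : Fin n)
      (a : SymTerm k E (m i)), (fun j => (Function.update s i a j).map φ) =
      Function.update (fun j => (s j).map φ) i (a.map φ) := fun m s i a =>
    funext fun j => Function.apply_update (fun _ => SymTerm.map φ) s i a j
  induction h with
  | refl t => exact .refl _
  | symm _ ih => exact ih.symm
  | trans _ _ ih ih' => exact ih.trans ih'
  | add_congr _ _ ih ih' => exact .add_congr ih ih'
  | smul_congr c _ ih => exact .smul_congr c ih
  | comp_congr m _ _ ih ih' => exact .comp_congr m ih ih'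
  | add_assoc r s t => exact .add_assoc _ _ _
  | add_comm s t => exact .add_comm _ _
  | zero_add t => exact .zero_add _
  | one_smul t => exact .one_smul _
  | zero_smul t => exact .zero_smul _
  | mul_smul c d t => exact .mul_smul c d _
  | add_smul c d t => exact .add_smul c d _
  | smul_add c s t => exact .smul_add c _ _
  | gen_add e f =>
    simp only [SymTerm.map, map_add]
    exact .gen_add _ _
  | gen_smul c e =>
    simp only [SymTerm.map, map_smul]
    exact .gen_smul c _
  | add_comp m t t' s => exact .add_comp m _ _ _
  | smul_comp m c t s => exact .smul_comp m c _ _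
  | comp_add m t s i a b =>
    simp only [SymTerm.map, hu]
    exact .comp_add m _ _ i _ _
  | comp_smul m t s i c a =>
    simp only [SymTerm.map, hu]
    exact .comp_smul m _ _ i c _
  | one_comp t =>
    rw [map_castOp (fun n => SymTerm.map (n := n) φ)]
    exact .one_comp _
  | comp_one t =>
    rw [map_castOp (fun n => SymTerm.map (n := n) φ)]
    exact .comp_one _
  | assoc m l r s t =>
    rw [map_castOp (fun n => SymTerm.map (n := n) φ)]
    exact .assoc m l _ _ _
  | relabel_congr σ _ ih => exact .relabel_congr σ ih
  | relabel_add σ s t => exact .relabel_add σ _ _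
  | relabel_smul σ c t => exact .relabel_smul σ c _
  | relabel_refl t => exact .relabel_refl _
  | relabel_trans σ τ t => exact .relabel_trans σ τ _
  | comp_relabel m m' τ t s => exact .comp_relabel m m' τ _ _
  | relabel_comp σ m t s => exact .relabel_comp σ m _ _
  | gen_swap e =>
    simp only [SymTerm.map, hφ]
    exact .gen_swap _

namespace SymOperad

/-- The map of free operads induced by an equivariant linear map of generators. -/
def freeMap (φ : E →ₗ[k] F) (hφ : ∀ e, φ (swap e) = swap' (φ e)) (n : ℕ) :
    FreeObj swap n →ₗ[k] FreeObj swap' n where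
  toFun := Quotient.map (SymTerm.map φ) (fun _ _ h => SymRel.map φ hφ h)
  map_add' := FreeObj.ind fun _ => FreeObj.ind fun _ => rfl
  map_smul' _ := FreeObj.ind fun _ => rfl

/-- The isomorphism of free operads induced by an equivariant isomorphism of generators. -/
def freeIso (φ : E ≃ₗ[k] F) (hφ : ∀ e, φ (swap e) = swap' (φ e)) :
    (free swap).Iso (free swap') where
  toEquiv n := LinearEquiv.ofLinearMap (freeMap φ.toLinearMap hφ n)
    (freeMap φ.symm.toLinearMap (fun e => by
      change φ.symm _ = swap (φ.symm e)
      rw [LinearEquiv.symm_apply_eq, hφ, LinearEquiv.apply_symm_apply]) n)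
    (LinearMap.ext <| FreeObj.ind fun t => congrArg (FreeObj.mk swap' n)
      (SymTerm.map_map_of_leftInverse φ.apply_symm_apply t))
    (LinearMap.ext <| FreeObj.ind fun t => congrArg (FreeObj.mk swap n)
      (SymTerm.map_map_of_leftInverse φ.symm_apply_apply t))
  map_one := rfl
  map_comp {n} m x y := by
    induction x using FreeObj.ind with | _ x
    obtain ⟨y, rfl⟩ := FreeObj.exists_rep m y
    change freeMap φ.toLinearMap hφ _ (FreeObj.comp _ _ _) =
      FreeObj.comp m (FreeObj.mk swap' n (x.map φ)) (fun i => FreeObj.mk swap' (m i) ((y i).map φ))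
    rw [FreeObj.comp_mk, FreeObj.comp_mk]
    rfl
  map_relabel σ x := by
    induction x using FreeObj.ind with | _ x
    rfl

end SymOperad

end SymFree

/-! ### Isomorphisms of symmetric quadratic data -/

namespace SymQuad

variable {k : Type u} [Field k] {E : Type v} [AddCommGroup E] [Module k E]
  {F : Type w} [AddCommGroup F] [Module k F]

/-- The map of quadratic elements induced by a linear isomorphism of generators. -/
def congr (φ : E ≃ₗ[k] F) : SymQuad k E ≃ₗ[k] SymQuad k F :=
  LinearEquiv.piCongrRight fun _ => TensorProduct.congr φ φ

end SymQuad

namespace SymQuadData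

variable {k : Type u} [Field k]

theorem freeIso_realize (D : SymQuadData.{u, v} k) (D' : SymQuadData.{u, w} k)
    (φ : D.E ≃ₗ[k] D'.E) (hφ : ∀ e, φ (D.swap e) = D'.swap (φ e)) (r : SymQuad k D.E) :
    (SymOperad.freeIso φ hφ).toEquiv 3 (D.realize r) = D'.realize (SymQuad.congr φ r) := by
  have h : ∀ t : D.E ⊗[k] D.E, (SymOperad.freeIso φ hφ).toEquiv 3
      (TensorProduct.lift ((SymOperad.free D.swap).leftComb.compl₁₂ (SymOperad.freeGen D.swap)
        (SymOperad.freeGen D.swap)) t) =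
      TensorProduct.lift ((SymOperad.free D'.swap).leftComb.compl₁₂ (SymOperad.freeGen D'.swap)
        (SymOperad.freeGen D'.swap)) (TensorProduct.congr φ φ t) := by
    intro t
    induction t using TensorProduct.induction_on with
    | zero => simp only [map_zero]
    | add s t hs ht => simp only [map_add, hs, ht]
    | tmul a b => exact (SymOperad.freeIso φ hφ).map_leftComb _ _
  simp only [realize, LinearMap.sum_apply, map_sum, LinearMap.comp_apply, LinearMap.proj_apply,
    (SymOperad.freeIso φ hφ).map_relabel, h]
  rfl

/-- An isomorphism of quadratic data induces an isomorphism of operads. -/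
theorem nonempty_iso (D : SymQuadData.{u, v} k) (D' : SymQuadData.{u, w} k) (φ : D.E ≃ₗ[k] D'.E)
    (hφ : ∀ e, φ (D.swap e) = D'.swap (φ e))
    (h : ∀ r, r ∈ D.R ↔ SymQuad.congr φ r ∈ D'.R) :
    Nonempty (D.operad.Iso D'.operad) := by
  refine ⟨(SymOperad.freeIso φ hφ).quotient _ _ fun n => le_antisymm ?_ ?_⟩
  · rw [Submodule.map_le_iff_le_comap]
    refine (SymOperad.freeIso φ hφ).idealSpan_le _ _ ?_ n
    rintro _ ⟨r, hr, rfl⟩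
    exact ⟨_, (h r).1 hr, by rw [freeIso_realize]⟩
  · rw [Submodule.map_equiv_eq_comap_symm]
    refine (SymOperad.freeIso φ hφ).symm.idealSpan_le _ _ ?_ n
    rintro _ ⟨r, hr, rfl⟩
    obtain ⟨r, rfl⟩ := (SymQuad.congr φ).surjective r
    refine ⟨r, (h r).2 hr, ?_⟩
    simp only [← freeIso_realize D D' φ hφ]
    exact congrArg (Sigma.mk 3) (LinearEquiv.symm_apply_apply _ _).symm

end SymQuadData

/-! ### Matching associative algebras -/

/-- In finite dimension `E* ⊗ E*` is the dual of `E ⊗ E`. -/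
theorem TensorProduct.eq_zero_of_forall_dualDistrib_eq_zero {k : Type u} [Field k] {E : Type v}
    [AddCommGroup E] [Module k E] [FiniteDimensional k E]
    {x : Module.Dual k E ⊗[k] Module.Dual k E}
    (h : ∀ t, TensorProduct.dualDistrib k E E x t = 0) : x = 0 :=
  (TensorProduct.dualDistribEquiv k E E).map_eq_zero_iff.1 (LinearMap.ext h)

namespace NSQuadData

variable {k : Type u} [Field k]

/-- The antidiagonal is the image of `E ⊗ E` under `t ↦ (t, -t)`, and the tensors of basis vectors
span `E ⊗ E`. The space `R` enters only through its generators and its minimality. -/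
theorem mem_iff_of_basis {E : Type v} [AddCommGroup E] [Module k E] {Ω : Type w}
    (b : Module.Basis Ω k E) {R : Submodule k ((E ⊗[k] E) × (E ⊗[k] E))}
    (hmem : ∀ μ ν, (b μ ⊗ₜ[k] b ν, -(b μ ⊗ₜ[k] b ν)) ∈ R)
    (hmin : ∀ N : Submodule k ((E ⊗[k] E) × (E ⊗[k] E)),
      (∀ μ ν, (b μ ⊗ₜ[k] b ν, -(b μ ⊗ₜ[k] b ν)) ∈ N) → R ≤ N)
    (r : (E ⊗[k] E) × (E ⊗[k] E)) : r ∈ R ↔ r.1 + r.2 = 0 := by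
  constructor
  · intro h
    have := hmin (LinearMap.ker (LinearMap.fst k (E ⊗[k] E) (E ⊗[k] E) +
      LinearMap.snd k (E ⊗[k] E) (E ⊗[k] E))) (fun μ ν => by simp) h
    simpa using this
  · intro h
    let f : E ⊗[k] E →ₗ[k] (E ⊗[k] E) × (E ⊗[k] E) := LinearMap.prod LinearMap.id (-LinearMap.id)
    have hr : r = f r.1 := Prod.ext rfl (eq_neg_of_add_eq_zero_right h)
    have hf : (⊤ : Submodule k (E ⊗[k] E)) ≤ R.comap f := by
      rw [← (b.tensorProduct b).span_eq, Submodule.span_le]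
      rintro _ ⟨⟨μ, ν⟩, rfl⟩
      rw [Module.Basis.tensorProduct_apply]
      exact hmem μ ν
    rw [hr]
    exact hf Submodule.mem_top

/-- Quadratic data with the relations of matching associative algebras are self-dual. -/
theorem isKoszulSelfDual_of_basis (D : NSQuadData.{u, v} k) {Ω : Type w} [Finite Ω]
    (b : Module.Basis Ω k D.E) (hmem : ∀ μ ν, (b μ ⊗ₜ[k] b ν, -(b μ ⊗ₜ[k] b ν)) ∈ D.R)
    (hmin : ∀ N : Submodule k ((D.E ⊗[k] D.E) × (D.E ⊗[k] D.E)),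
      (∀ μ ν, (b μ ⊗ₜ[k] b ν, -(b μ ⊗ₜ[k] b ν)) ∈ N) → D.R ≤ N) :
    D.IsKoszulSelfDual := by
  classical
  have hR := mem_iff_of_basis b hmem hmin
  have : FiniteDimensional k D.E := b.finiteDimensional_of_finite
  let φ : Module.Dual k D.E ≃ₗ[k] D.E := b.toDualEquiv.symm
  have key : ∀ x : (Module.Dual k D.E ⊗[k] Module.Dual k D.E) ×
      (Module.Dual k D.E ⊗[k] Module.Dual k D.E), (∀ r ∈ D.R, pairing D.E x r = 0) ↔
        (TensorProduct.congr φ φ).prodCongr (TensorProduct.congr φ φ) x ∈ D.R := by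
    intro x
    rw [hR, LinearEquiv.prodCongr_apply, ← map_add, LinearEquiv.map_eq_zero_iff]
    constructor
    · intro h
      refine TensorProduct.eq_zero_of_forall_dualDistrib_eq_zero fun t => ?_
      -- The minus sign of the pairing cancels the one in `(t, -t)`, so this tests `x.1 + x.2` on an
      -- arbitrary `t`.
      have := h (t, -t) ((hR _).2 (add_neg_cancel t))
      simpa only [pairing, map_neg, sub_neg_eq_add, map_add, LinearMap.add_apply] using this
    · intro h r hr
      have h1 : r.2 = -r.1 := eq_neg_of_add_eq_zero_right ((hR r).1 hr)
      rw [pairing, h1, map_neg, sub_neg_eq_add, ← LinearMap.add_apply, ← map_add, h, map_zero,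
        LinearMap.zero_apply]
  exact nonempty_iso D.koszulDual D φ key

/-- A universal property of the matching relations: taking `N` to be the supremum itself yields the
generators, and a general `N` yields minimality. -/
theorem iSup_map_span_le_iff {E : Type v} [AddCommGroup E] [Module k E] {F : Type w}
    [AddCommGroup F] [Module k F] {Ω : Type*} (e : E) (i : Ω → E →ₗ[k] F)
    (N : Submodule k ((F ⊗[k] F) × (F ⊗[k] F))) :
    (⨆ (μ : Ω) (ν : Ω), (Submodule.span k {(e ⊗ₜ[k] e, -(e ⊗ₜ[k] e))}).map
      ((TensorProduct.map (i μ) (i ν)).prodMap (TensorProduct.map (i μ) (i ν)))) ≤ N ↔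
      ∀ μ ν, (i μ e ⊗ₜ[k] i ν e, -(i μ e ⊗ₜ[k] i ν e)) ∈ N := by
  simp only [iSup_le_iff, Submodule.map_span, Set.image_singleton, LinearMap.prodMap_apply,
    TensorProduct.map_tmul, map_neg, Submodule.span_le, Set.singleton_subset_iff, SetLike.mem_coe]

theorem isKoszulSelfDual_matching_assoc (Ω : Type v) [Finite Ω] :
    ((assoc k).matching Ω).IsKoszulSelfDual := by
  let b : Module.Basis Ω k ((assoc k).matching Ω).E := Finsupp.basisSingleOne (R := k) (ι := Ω)
  let i : Ω → (assoc k).E →ₗ[k] ((assoc k).matching Ω).E := fun μ => Finsupp.lsingle (R := k) μ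
  have hb : ∀ μ, b μ = i μ (1 : k) := fun μ => congrFun Finsupp.coe_basisSingleOne μ
  have key := iSup_map_span_le_iff (E := (assoc k).E) (1 : k) i
  simp only [← hb] at key
  exact isKoszulSelfDual_of_basis _ b ((key _).1 le_rfl) fun N => (key N).2

end NSQuadData

/-! ### Matching Poisson algebras -/

namespace SymQuad

variable {k : Type u} [Field k] {E : Type v} [AddCommGroup E] [Module k E]
  {F : Type w} [AddCommGroup F] [Module k F]

theorem congr_flip (φ : E ≃ₗ[k] F) {swap : E →ₗ[k] E} {swap' : F →ₗ[k] F}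
    (hφ : ∀ e, φ (swap e) = swap' (φ e)) (t : SymQuad k E) :
    congr φ (flip swap t) = flip swap' (congr φ t) := by
  have h : ∀ t : E ⊗[k] E, TensorProduct.congr φ φ (TensorProduct.map swap LinearMap.id t) =
      TensorProduct.map swap' LinearMap.id (TensorProduct.congr φ φ t) := by
    intro t
    induction t using TensorProduct.induction_on with
    | zero => simp only [map_zero]
    | add s t hs ht => simp only [map_add, hs, ht]
    | tmul a b => simp [hφ]
  exact funext fun u => h _

theorem pairing_add_right (x : SymQuad k (Module.Dual k E)) (r r' : SymQuad k E) :
    pairing x (r + r') = pairing x r + pairing x r' := by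
  simp [pairing, Finset.sum_add_distrib]

theorem pairing_smul_right (x : SymQuad k (Module.Dual k E)) (c : k) (r : SymQuad k E) :
    pairing x (c • r) = c * pairing x r := by
  simp [pairing, Finset.mul_sum]

theorem pairing_tree (x : SymQuad k (Module.Dual k E)) (u : Fin 3) (a b : E) :
    pairing x (tree u a b) = TensorProduct.dualDistrib k E E (x u) (a ⊗ₜ b) := by
  rw [pairing, Finset.sum_eq_single u]
  · simp [tree]
  · intro v _ hv
    simp [tree, Pi.single_eq_of_ne hv]
  · simp

/-- Pairing with a fixed element, as a linear map. -/
def pairingLeft (x : SymQuad k (Module.Dual k E)) : SymQuad k E →ₗ[k] k where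
  toFun := pairing x
  map_add' := pairing_add_right x
  map_smul' := pairing_smul_right x

theorem cyc_tree (u : Fin 3) (a b : E) : cyc (tree (k := k) (u + 1) a b) = tree u a b := by
  funext v
  simp only [cyc, LinearMap.funLeft_apply, tree, Pi.single_apply, add_left_inj]

/-! ### Coordinates of quadratic elements -/

variable {ι : Type*}

/-- The coefficient of `(x_u (b p) x_{u+1}) (b q) x_{u+2}`. -/
def coeff (b : Module.Basis ι k E) (u : Fin 3) (p q : ι) : SymQuad k E →ₗ[k] k :=
  (b.tensorProduct b).coord (p, q) ∘ₗ LinearMap.proj u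

theorem coeff_tree [DecidableEq ι] (b : Module.Basis ι k E) (u v : Fin 3) (p q p' q' : ι) :
    coeff b u p q (tree v (b p') (b q')) = if u = v ∧ p = p' ∧ q = q' then 1 else 0 := by
  by_cases h : u = v
  · subst h
    have h1 : (tree u (b p') (b q') : SymQuad k E) u = b p' ⊗ₜ b q' := Pi.single_eq_same _ _
    simp only [coeff, LinearMap.comp_apply, LinearMap.proj_apply, h1, Module.Basis.coord_apply,
      Module.Basis.tensorProduct_repr_tmul_apply, Module.Basis.repr_self, Finsupp.single_apply]
    by_cases hp : p = p' <;> by_cases hq : q = q' <;> simp [hp, hq, Ne.symm]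
  · have h1 : (tree v (b p') (b q') : SymQuad k E) u = 0 := Pi.single_eq_of_ne h _
    simp [coeff, h1, h]

theorem coeff_cyc (b : Module.Basis ι k E) (u : Fin 3) (p q : ι) (t : SymQuad k E) :
    coeff b u p q (cyc t) = coeff b (u + 1) p q t :=
  rfl

/-- Exchanging `x₀` and `x₁` reverses the inputs of the inner operation only, so the sign depends on
`p` and not on `q`. -/
theorem coeff_flip (b : Module.Basis ι k E) {swap : E →ₗ[k] E} {ε : ι → k}
    (hε : ∀ i, swap (b i) = ε i • b i) (u : Fin 3) (p q : ι) (t : SymQuad k E) :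
    coeff b u p q (flip swap t) = ε p * coeff b (-u) p q t := by
  suffices h : (b.tensorProduct b).coord (p, q) ∘ₗ TensorProduct.map swap LinearMap.id =
      ε p • (b.tensorProduct b).coord (p, q) from LinearMap.congr_fun h (t (-u))
  classical
  refine (b.tensorProduct b).ext fun ⟨i, j⟩ => ?_
  by_cases hi : i = p
  · subst hi
    simp [hε, Module.Basis.tensorProduct_apply, mul_comm]
  · simp [hε, Module.Basis.tensorProduct_apply, Finsupp.single_apply, hi]

theorem sum_coeff [Fintype ι] (b : Module.Basis ι k E) (t : SymQuad k E) :
    ∑ p, ∑ q, ∑ u, coeff b u p q t • tree u (b p) (b q) = t := by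
  funext v
  simp only [Finset.sum_apply, Pi.smul_apply]
  rw [← (b.tensorProduct b).sum_repr (t v), Fintype.sum_prod_type]
  refine Finset.sum_congr rfl fun p _ => Finset.sum_congr rfl fun q _ => ?_
  rw [Finset.sum_eq_single v, Module.Basis.tensorProduct_apply]
  · simp [tree, coeff]
  · intro u _ hu
    simp [tree, Pi.single_eq_of_ne hu.symm]
  · simp

/-- The dictionary for orthogonality: if `φ` sends the dual basis vector of `b p` to `b (σ p)`,
pairing with a tree reads off a coordinate of the transported element, so being orthogonal to a
relation becomes a linear equation on coordinates. -/
theorem pairing_tree_eq_coeff [Finite ι] (b : Module.Basis ι k E) (σ : ι → ι)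
    (φ : Module.Dual k E ≃ₗ[k] E) (hφ : ∀ f p, b.repr (φ f) (σ p) = f (b p)) (u : Fin 3) (p q : ι)
    (x : SymQuad k (Module.Dual k E)) :
    pairing x (tree u (b p) (b q)) = coeff b u (σ p) (σ q) (congr φ x) := by
  rw [pairing_tree]
  change _ = (b.tensorProduct b).repr (TensorProduct.congr φ φ (x u)) (σ p, σ q)
  induction x u using TensorProduct.induction_on with
  | zero => simp
  | add s t hs ht => simp only [map_add, LinearMap.add_apply, Finsupp.add_apply, hs, ht]
  | tmul f g => simp [hφ, mul_comm]

/-! ### The Poisson relations by generators and by equations -/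

/-- The defining relations of matching Poisson algebras in terms of a basis `b` of operations, with
products `b (ω, true)` and brackets `b (ω, false)`, where the labels on the right hand side of the
Leibniz rule are permuted by `s`. -/
def HasPoissonRel {Ω : Type*} (b : Module.Basis (Ω × Bool) k E) (s : Ω × Ω → Ω × Ω)
    (N : Submodule k (SymQuad k E)) : Prop :=
  ∀ ω : Ω × Ω,
    tree 0 (b (ω.1, true)) (b (ω.2, true)) - tree 1 (b (ω.1, true)) (b (ω.2, true)) ∈ N ∧
    tree 0 (b (ω.1, false)) (b (ω.2, false)) + tree 1 (b (ω.1, false)) (b (ω.2, false)) +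
      tree 2 (b (ω.1, false)) (b (ω.2, false)) ∈ N ∧
    tree 0 (b (ω.1, true)) (b (ω.2, false)) - tree 1 (b ((s ω).1, false)) (b ((s ω).2, true)) +
      tree 2 (b ((s ω).1, false)) (b ((s ω).2, true)) ∈ N

/-- The space of consequences in arity three of the relations of matching Poisson algebras, in
coordinates. -/
def poissonRel {Ω : Type*} (b : Module.Basis (Ω × Bool) k E) (s : Ω × Ω → Ω × Ω) :
    Submodule k (SymQuad k E) :=
  ⨅ ω : Ω × Ω,
    LinearMap.ker (coeff b 0 (ω.1, true) (ω.2, true) + coeff b 1 (ω.1, true) (ω.2, true) +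
      coeff b 2 (ω.1, true) (ω.2, true)) ⊓
    ⨅ u : Fin 3,
      LinearMap.ker (coeff b u (ω.1, false) (ω.2, false) -
        coeff b (u + 1) (ω.1, false) (ω.2, false)) ⊓
      LinearMap.ker (coeff b u ((s ω).1, false) ((s ω).2, true) -
        coeff b (u + 1) (ω.1, true) (ω.2, false) + coeff b (u + 2) (ω.1, true) (ω.2, false))

section Poisson

variable {Ω : Type*} (b : Module.Basis (Ω × Bool) k E) (s : Ω × Ω → Ω × Ω)

/-- For each `ω` the equations describe three blocks. The cyclic translates of associativity span
the triples with sum zero, Jacobi spans the constant triples, and the three translates of Leibniz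
span the graph that expresses the coordinate of type `lc` in component `u` as the difference of
those of type `cl` in components `u + 1` and `u + 2`. -/
theorem mem_poissonRel_iff (t : SymQuad k E) : t ∈ poissonRel b s ↔ ∀ ω : Ω × Ω,
    coeff b 0 (ω.1, true) (ω.2, true) t + coeff b 1 (ω.1, true) (ω.2, true) t +
      coeff b 2 (ω.1, true) (ω.2, true) t = 0 ∧
    ∀ u : Fin 3,
      coeff b u (ω.1, false) (ω.2, false) t - coeff b (u + 1) (ω.1, false) (ω.2, false) t = 0 ∧
      coeff b u ((s ω).1, false) ((s ω).2, true) t -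
        coeff b (u + 1) (ω.1, true) (ω.2, false) t +
        coeff b (u + 2) (ω.1, true) (ω.2, false) t = 0 := by
  simp [poissonRel, Submodule.mem_iInf]

/-- A cyclic permutation only shifts `u`. The transposition replaces `u` by `-u`, which exchanges
the roles of `u + 1` and `u + 2` in the mixed equation; the resulting sign is matched by the sign of
the bracket in the `lc` term. -/
theorem isStable_poissonRel {swap : E →ₗ[k] E} (hc : ∀ ω, swap (b (ω, true)) = b (ω, true))
    (hl : ∀ ω, swap (b (ω, false)) = -b (ω, false)) : IsStable swap (poissonRel b s) := by
  have hε : ∀ i, swap (b i) = (if i.2 then 1 else -1 : k) • b i := by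
    rintro ⟨ω, _ | _⟩ <;> simp [hc, hl]
  constructor <;> intro t ht <;> rw [mem_poissonRel_iff] at ht ⊢ <;> intro ω <;>
    obtain ⟨h1, h2⟩ := ht ω
  · simp only [coeff_cyc]
    refine ⟨?_, fun u => ?_⟩
    · simp only [Fin.isValue, zero_add, show (1 + 1 : Fin 3) = 2 from rfl,
        show (2 + 1 : Fin 3) = 0 from rfl]
      linear_combination h1
    · have h3 := h2 (u + 1)
      rw [add_right_comm u 2 1]
      exact h3
  · simp only [coeff_flip b hε]
    have e := h2 0
    have e' := h2 1
    have e'' := h2 2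
    simp only [Fin.isValue, zero_add, show (1 + 1 : Fin 3) = 2 from rfl,
      show (2 + 1 : Fin 3) = 0 from rfl, show (1 + 2 : Fin 3) = 0 from rfl,
      show (2 + 2 : Fin 3) = 1 from rfl] at e e' e''
    refine ⟨?_, fun u => ?_⟩
    · simp only [Fin.isValue, show (-0 : Fin 3) = 0 from rfl, show (-1 : Fin 3) = 2 from rfl,
        show (-2 : Fin 3) = 1 from rfl]
      simp only [if_true]
      linear_combination h1
    · fin_cases u <;> simp [show (-0 : Fin 3) = 0 from rfl, show (-1 : Fin 3) = 2 from rfl,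
        show (-2 : Fin 3) = 1 from rfl, show (1 + 1 : Fin 3) = 2 from rfl,
        show (2 + 1 : Fin 3) = 0 from rfl, show (1 + 2 : Fin 3) = 0 from rfl,
        show (2 + 2 : Fin 3) = 1 from rfl]
      · exact ⟨by linear_combination e''.1, by linear_combination -e.2⟩
      · exact ⟨by linear_combination e'.1, by linear_combination -e''.2⟩
      · exact ⟨by linear_combination e.1, by linear_combination -e'.2⟩

theorem hasPoissonRel_poissonRel (hs : Function.Injective s) :
    HasPoissonRel b s (poissonRel b s) := by
  classical
  intro ω
  simp only [mem_poissonRel_iff, map_add, map_sub, coeff_tree]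
  refine ⟨fun ω' => ?_, fun ω' => ?_, fun ω' => ?_⟩
  · by_cases h : ω' = ω
    · subst h
      simp
    · have h' : ¬(ω'.1 = ω.1 ∧ ω'.2 = ω.2) := fun e => h (Prod.ext e.1 e.2)
      simp [h']
  · by_cases h : ω' = ω
    · subst h
      refine ⟨by simp, fun u => ?_⟩
      fin_cases u <;> simp [show (1 + 1 : Fin 3) = 2 from rfl, show (2 + 1 : Fin 3) = 0 from rfl]
    · have h' : ¬(ω'.1 = ω.1 ∧ ω'.2 = ω.2) := fun e => h (Prod.ext e.1 e.2)
      simp [h']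
  · by_cases h : ω' = ω
    · subst h
      refine ⟨by simp, fun u => ?_⟩
      fin_cases u <;> simp [show (1 + 1 : Fin 3) = 2 from rfl, show (2 + 1 : Fin 3) = 0 from rfl,
        show (1 + 2 : Fin 3) = 0 from rfl, show (2 + 2 : Fin 3) = 1 from rfl]
    · have h' : ¬(ω'.1 = ω.1 ∧ ω'.2 = ω.2) := fun e => h (Prod.ext e.1 e.2)
      -- Injectivity of `s` keeps the mixed blocks of distinct label pairs disjoint.
      have h'' : ¬((s ω').1 = (s ω).1 ∧ (s ω').2 = (s ω).2) :=
        fun e => h (hs (Prod.ext e.1 e.2))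
      simp [h', h'']

/-- Solving the equations block by block writes each solution explicitly as a combination of the
cyclic translates of the three relations. -/
theorem poissonRel_le [Finite Ω] (hs : Function.Bijective s) {swap : E →ₗ[k] E}
    {N : Submodule k (SymQuad k E)} (hN : IsStable swap N) (h : HasPoissonRel b s N) :
    poissonRel b s ≤ N := by
  intro t ht
  rw [mem_poissonRel_iff] at ht
  cases nonempty_fintype Ω
  let f : Ω × Ω → Bool → Bool → SymQuad k E := fun ω i j =>
    ∑ u, coeff b u (ω.1, i) (ω.2, j) t • tree u (b (ω.1, i)) (b (ω.2, j))
  -- The block of type `lc` is reindexed along the bijection `s`, so that it sits next to the block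
  -- of type `cl` to which the Leibniz rule ties it.
  have hsum : ∑ ω, f ω true true + ∑ ω, f ω false false +
      ∑ ω, (f ω true false + f (s ω) false true) = t := by
    rw [Finset.sum_add_distrib, hs.sum_comp (fun ω => f ω false true)]
    conv_rhs => rw [← sum_coeff b t]
    simp only [Fintype.sum_prod_type, Fintype.sum_bool, Finset.sum_add_distrib, f]
    abel
  have hcyc : ∀ r ∈ N, cyc r ∈ N ∧ cyc (cyc r) ∈ N := fun r hr =>
    ⟨hN.1 r hr, hN.1 _ (hN.1 r hr)⟩
  have c0 : ∀ a b : E, cyc (tree (k := k) 0 a b) = tree 2 a b := cyc_tree 2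
  have c1 : ∀ a b : E, cyc (tree (k := k) 1 a b) = tree 0 a b := cyc_tree 0
  have c2 : ∀ a b : E, cyc (tree (k := k) 2 a b) = tree 1 a b := cyc_tree 1
  rw [← hsum]
  refine add_mem (add_mem (sum_mem fun ω _ => ?_) (sum_mem fun ω _ => ?_))
    (sum_mem fun ω _ => ?_)
  · obtain ⟨h1, -⟩ := ht ω
    have g := (h ω).1
    have g' := (hcyc _ g).2
    simp only [map_sub, c0, c1, c2] at g'
    -- Here `g` is component 0 minus component 1 and `g'` is component 1 minus component 2; the
    -- outer coordinates fix the weights, and the middle one follows from the vanishing sum.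
    convert! add_mem (N.smul_mem (coeff b 0 (ω.1, true) (ω.2, true) t) g)
      (N.smul_mem (-coeff b 2 (ω.1, true) (ω.2, true) t) g') using 1
    simp only [f, Fin.sum_univ_three]
    have e : coeff b 1 (ω.1, true) (ω.2, true) t = -coeff b 0 (ω.1, true) (ω.2, true) t -
        coeff b 2 (ω.1, true) (ω.2, true) t := by linear_combination h1
    rw [e]
    module
  · obtain ⟨-, h2⟩ := ht ω
    have e0 := sub_eq_zero.1 (h2 0).1
    have e1 := sub_eq_zero.1 (h2 1).1
    simp only [Fin.isValue, zero_add, show (1 + 1 : Fin 3) = 2 from rfl] at e0 e1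
    convert! N.smul_mem (coeff b 2 (ω.1, false) (ω.2, false) t) (h ω).2.1 using 1
    simp only [f, Fin.sum_univ_three, e0, e1]
    module
  · obtain ⟨-, h2⟩ := ht ω
    have g := (h ω).2.2
    obtain ⟨g', g''⟩ := hcyc _ g
    simp only [map_sub, map_add, c0, c1, c2] at g' g''
    have e := (h2 0).2
    have e' := (h2 1).2
    have e'' := (h2 2).2
    simp only [Fin.isValue, zero_add, show (1 + 1 : Fin 3) = 2 from rfl,
      show (2 + 1 : Fin 3) = 0 from rfl, show (1 + 2 : Fin 3) = 0 from rfl,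
      show (2 + 2 : Fin 3) = 1 from rfl] at e e' e''
    rw [sub_add, sub_eq_zero] at e e' e''
    -- The terms of type `cl` in `g`, `g'`, `g''` lie in components 0, 2, 1, which dictates the
    -- weights; the `lc` terms then agree by the mixed equations.
    convert! add_mem (add_mem (N.smul_mem (coeff b 0 (ω.1, true) (ω.2, false) t) g)
      (N.smul_mem (coeff b 2 (ω.1, true) (ω.2, false) t) g'))
      (N.smul_mem (coeff b 1 (ω.1, true) (ω.2, false) t) g'') using 1
    simp only [f, Fin.sum_univ_three, e, e', e'']
    module

/-- Through `φ`, pairing with the relations and their cyclic translates gives the equations of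
`poissonRel`, with associativity and Jacobi interchanged. Conversely, the elements orthogonal to all
solutions form a stable space containing the generators, hence all of `R` by minimality. -/
theorem forall_pairing_eq_zero_iff [Finite Ω] (hs : Function.Involutive s) {swap : E →ₗ[k] E}
    (hc : ∀ ω, swap (b (ω, true)) = b (ω, true)) (hl : ∀ ω, swap (b (ω, false)) = -b (ω, false))
    (φ : Module.Dual k E ≃ₗ[k] E) (hφ : ∀ f p, b.repr (φ f) (p.1, !p.2) = f (b p))
    (hswap : ∀ f, φ ((-Module.Dual.transpose (R := k) swap) f) = swap (φ f))
    {R : Submodule k (SymQuad k E)} (hR : IsStable swap R) (hrel : HasPoissonRel b s R)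
    (hmin : ∀ N, IsStable swap N → HasPoissonRel b s N → R ≤ N)
    (x : SymQuad k (Module.Dual k E)) :
    (∀ r ∈ R, pairing x r = 0) ↔ congr φ x ∈ poissonRel b s := by
  have hp := pairing_tree_eq_coeff b (fun p => (p.1, !p.2)) φ hφ
  have hsub : ∀ (x : SymQuad k (Module.Dual k E)) (r r' : SymQuad k E),
      pairing x (r - r') = pairing x r - pairing x r' := fun x => (pairingLeft x).map_sub
  constructor
  · intro h
    have h0 := fun ω => h _ (hrel ω).1
    have h0' := fun ω => h _ (hR.1 _ (hR.1 _ (hrel ω).1))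
    have h1 := fun ω => h _ (hrel ω).2.1
    -- The relation is taken at `s ω`: `φ` turns its left hand side into type `lc` with labels `s ω`
    -- and its right hand side into type `cl` with labels `s (s ω) = ω`, as in the mixed equation at
    -- `ω`.
    have h2 := fun ω => h _ (hrel (s ω)).2.2
    have h2' := fun ω => h _ (hR.1 _ (hrel (s ω)).2.2)
    have h2'' := fun ω => h _ (hR.1 _ (hR.1 _ (hrel (s ω)).2.2))
    have c0 : ∀ a b : E, cyc (tree (k := k) 0 a b) = tree 2 a b := cyc_tree 2
    have c1 : ∀ a b : E, cyc (tree (k := k) 1 a b) = tree 0 a b := cyc_tree 0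
    have c2 : ∀ a b : E, cyc (tree (k := k) 2 a b) = tree 1 a b := cyc_tree 1
    simp only [map_sub, map_add, c0, c1, c2, hsub, pairing_add_right, hp, hs _, Bool.not_true,
      Bool.not_false] at h0 h0' h1 h2 h2' h2''
    rw [mem_poissonRel_iff]
    refine fun ω => ⟨h1 ω, fun u => ?_⟩
    fin_cases u <;> simp only [Fin.zero_eta, Fin.mk_one, Fin.reduceFinMk, Fin.isValue, zero_add,
      show (1 + 1 : Fin 3) = 2 from rfl,
      show (2 + 1 : Fin 3) = 0 from rfl, show (1 + 2 : Fin 3) = 0 from rfl,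
      show (2 + 2 : Fin 3) = 1 from rfl]
    · exact ⟨h0 ω, h2 ω⟩
    · exact ⟨h0' ω, h2'' ω⟩
    -- The third equality of coordinates of type `ll` follows from the other two.
    · exact ⟨by linear_combination -h0 ω - h0' ω, h2' ω⟩
  · intro hx r hr
    let N : Submodule k (SymQuad k E) :=
      ⨅ (x : SymQuad k (Module.Dual k E)) (_ : congr φ x ∈ poissonRel b s),
        LinearMap.ker (pairingLeft x)
    have hN : ∀ r, r ∈ N ↔ ∀ x, congr φ x ∈ poissonRel b s → pairing x r = 0 := fun r => by
      simp only [N, Submodule.mem_iInf, LinearMap.mem_ker]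
      rfl
    have hL := isStable_poissonRel b s hc hl
    refine (hN r).1 (hmin N ⟨fun t ht => ?_, fun t ht => ?_⟩ (fun ω => ?_) hr) x hx
    · rw [hN] at ht ⊢
      intro x hx
      -- The adjoint of `cyc` is its square, so this pairs `x` with the fourth iterate of `cyc` on
      -- `t`, which is `cyc t`.
      have h1 := ht (cyc (cyc x)) (hL.1 _ (hL.1 _ hx))
      rw [pairing_cyc, pairing_cyc] at h1
      exact h1
    · rw [hN] at ht ⊢
      intro x hx
      have h1 := ht (flip (-Module.Dual.transpose (R := k) swap) x)
        (by rw [congr_flip φ hswap]; exact hL.2 _ hx)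
      rwa [pairing_flip, neg_eq_zero] at h1
    · simp only [hN, hsub, pairing_add_right, hp, Bool.not_true, Bool.not_false]
      refine ⟨fun x hx => ?_, fun x hx => ?_, fun x hx => ?_⟩ <;> rw [mem_poissonRel_iff] at hx
      · exact ((hx ω).2 0).1
      · exact (hx ω).1
      · have := ((hx (s ω)).2 0).2
        rwa [hs ω] at this

end Poisson

end SymQuad

/-! ### Self-duality from a basis of products and brackets -/

namespace SymQuadData

variable {k : Type u} [Field k]

/-- Quadratic data with the relations of matching Poisson algebras are self-dual. -/
theorem isKoszulSelfDual_of_hasPoissonRel (D : SymQuadData.{u, v} k) {Ω : Type w} [Finite Ω]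
    (b : Module.Basis (Ω × Bool) k D.E) {s : Ω × Ω → Ω × Ω} (hs : Function.Involutive s)
    (hc : ∀ ω, D.swap (b (ω, true)) = b (ω, true))
    (hl : ∀ ω, D.swap (b (ω, false)) = -b (ω, false))
    (hrel : SymQuad.HasPoissonRel b s D.R)
    (hmin : ∀ N, SymQuad.IsStable D.swap N → SymQuad.HasPoissonRel b s N → D.R ≤ N) :
    D.IsKoszulSelfDual := by
  classical
  let σ : Ω × Bool ≃ Ω × Bool := (Equiv.refl Ω).prodCongr Equiv.boolNot
  -- Products and brackets are exchanged, labels kept: the dual of a product becomes antisymmetric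
  -- after the sign twist, so it must go to a bracket.
  let φ : Module.Dual k D.E ≃ₗ[k] D.E := b.dualBasis.equiv b σ
  have hφb : ∀ p, φ (b.dualBasis p) = b (p.1, !p.2) := fun p => b.dualBasis.equiv_apply p b σ
  have hφ : ∀ (f : Module.Dual k D.E) p, b.repr (φ f) (p.1, !p.2) = f (b p) := by
    intro f p
    suffices h : b.coord (p.1, !p.2) ∘ₗ φ.toLinearMap = LinearMap.applyₗ (b p) from
      LinearMap.congr_fun h f
    refine b.dualBasis.ext fun q => ?_
    change b.repr (φ (b.dualBasis q)) (p.1, !p.2) = b.dualBasis q (b p)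
    rw [hφb, Module.Basis.repr_self, Module.Basis.dualBasis_apply_self, Finsupp.single_apply]
    obtain ⟨μ, i⟩ := p
    obtain ⟨ν, j⟩ := q
    cases i <;> cases j <;> simp [eq_comm]
  have hε : ∀ i, D.swap (b i) = (if i.2 then 1 else -1 : k) • b i := by
    rintro ⟨ω, _ | _⟩ <;> simp [hc, hl]
  have hswap : ∀ f, φ ((-Module.Dual.transpose (R := k) D.swap) f) = D.swap (φ f) := by
    intro f
    suffices h : φ.toLinearMap ∘ₗ (-Module.Dual.transpose (R := k) D.swap) =
        D.swap ∘ₗ φ.toLinearMap from LinearMap.congr_fun h f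
    refine b.dualBasis.ext fun q => ?_
    have h1 : Module.Dual.transpose (R := k) D.swap (b.dualBasis q) =
        (if q.2 then 1 else -1 : k) • b.dualBasis q := by
      refine b.ext fun p => ?_
      simp only [Module.Dual.transpose_apply, LinearMap.comp_apply, hε, map_smul,
        LinearMap.smul_apply, Module.Basis.dualBasis_apply_self]
      by_cases hpq : p = q
      · simp [hpq]
      · simp [hpq]
    simp only [LinearMap.comp_apply, LinearMap.neg_apply, h1, map_neg, map_smul,
      LinearEquiv.coe_coe, hφb, hε]
    obtain ⟨ν, j⟩ := q
    cases j <;> simp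
  have hR : D.R = SymQuad.poissonRel b s :=
    le_antisymm (hmin _ (SymQuad.isStable_poissonRel b s hc hl)
      (SymQuad.hasPoissonRel_poissonRel b s hs.injective))
      (SymQuad.poissonRel_le b s hs.bijective D.stable hrel)
  have key := SymQuad.forall_pairing_eq_zero_iff b s hs hc hl φ hφ hswap D.stable hrel hmin
  rw [← hR] at key
  exact nonempty_iso D.koszulDual D φ hswap key

end SymQuadData

/-! ### Generators of the matching relations -/

namespace SymQuad

variable {k : Type u} [Field k] {E : Type v} [AddCommGroup E] [Module k E]
  {F : Type w} [AddCommGroup F] [Module k F]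

/-- The map of quadratic elements induced by a pair of linear maps of generators. -/
def map₂ (f g : E →ₗ[k] F) : SymQuad k E →ₗ[k] SymQuad k F :=
  LinearMap.compLeft (TensorProduct.map f g) (Fin 3)

theorem map₂_tree (f g : E →ₗ[k] F) (u : Fin 3) (a b : E) :
    map₂ f g (tree u a b) = tree u (f a) (g b) := by
  funext v
  by_cases h : v = u
  · subst h
    simp [map₂, tree]
  · simp [map₂, tree, Pi.single_eq_of_ne h]

theorem map₂_flip (f g : E →ₗ[k] F) {swap : E →ₗ[k] E} {swap' : F →ₗ[k] F}
    (hf : ∀ e, f (swap e) = swap' (f e)) (t : SymQuad k E) :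
    map₂ f g (flip swap t) = flip swap' (map₂ f g t) := by
  have h : ∀ t : E ⊗[k] E, TensorProduct.map f g (TensorProduct.map swap LinearMap.id t) =
      TensorProduct.map swap' LinearMap.id (TensorProduct.map f g t) := by
    intro t
    induction t using TensorProduct.induction_on with
    | zero => simp only [map_zero]
    | add s t hs ht => simp only [map_add, hs, ht]
    | tmul a b => simp [hf]
  exact funext fun u => h _

/-- Only `f` has to be equivariant, because `flip` acts on the inner operation, to which `f` is
applied. -/
theorem IsStable.comap {f g : E →ₗ[k] F} {swap : E →ₗ[k] E} {swap' : F →ₗ[k] F}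
    (hf : ∀ e, f (swap e) = swap' (f e)) {N : Submodule k (SymQuad k F)}
    (hN : IsStable swap' N) : IsStable swap (N.comap (map₂ f g)) := by
  refine ⟨fun t ht => hN.1 _ ht, fun t ht => ?_⟩
  rw [Submodule.mem_comap, map₂_flip f g hf]
  exact hN.2 _ ht

theorem subset_stableSpan (swap : E →ₗ[k] E) (S : Set (SymQuad k E)) : S ⊆ stableSpan swap S := by
  intro t ht
  simp only [stableSpan, Submodule.mem_sInf, SetLike.mem_coe]
  exact fun R hR => hR.1 ht

theorem stableSpan_le {swap : E →ₗ[k] E} {S : Set (SymQuad k E)} {N : Submodule k (SymQuad k E)}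
    (hN : IsStable swap N) (h : S ⊆ N) : stableSpan swap S ≤ N :=
  sInf_le ⟨h, hN⟩

/-- The matching construction labels every consequence of the Poisson relations in arity three.
Labelling by a fixed pair commutes with `cyc` and `flip`, so it suffices to label the three
generators. -/
theorem stableSpan_map₂_le_iff {Ω : Type*} (i : Ω → E →ₗ[k] F) {swap : E →ₗ[k] E}
    {swap' : F →ₗ[k] F} (hi : ∀ μ e, i μ (swap e) = swap' (i μ e)) (c l : E)
    {N : Submodule k (SymQuad k F)} (hN : IsStable swap' N) :
    stableSpan swap' {t | ∃ (μ ν : Ω), ∃ r ∈ stableSpan swap {tree 0 c c - tree 1 c c,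
      tree 0 l l + tree 1 l l + tree 2 l l, tree 0 c l - tree 1 l c + tree 2 l c},
      t = map₂ (i μ) (i ν) r} ≤ N ↔ ∀ μ ν,
      tree 0 (i μ c) (i ν c) - tree 1 (i μ c) (i ν c) ∈ N ∧
      tree 0 (i μ l) (i ν l) + tree 1 (i μ l) (i ν l) + tree 2 (i μ l) (i ν l) ∈ N ∧
      tree 0 (i μ c) (i ν l) - tree 1 (i μ l) (i ν c) + tree 2 (i μ l) (i ν c) ∈ N := by
  simp only [← map₂_tree, ← map_add, ← map_sub]
  constructor
  · intro h μ ν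
    have hmem : ∀ r ∈ ({tree 0 c c - tree 1 c c, tree 0 l l + tree 1 l l + tree 2 l l,
        tree 0 c l - tree 1 l c + tree 2 l c} : Set (SymQuad k E)), map₂ (i μ) (i ν) r ∈ N :=
      fun r hr => h (subset_stableSpan _ _ ⟨μ, ν, r, subset_stableSpan _ _ hr, rfl⟩)
    exact ⟨hmem _ (.inl rfl), hmem _ (.inr (.inl rfl)), hmem _ (.inr (.inr rfl))⟩
  · intro h
    refine stableSpan_le hN ?_
    rintro _ ⟨μ, ν, r, hr, rfl⟩
    refine stableSpan_le (hN.comap (f := i μ) (g := i ν) (hi μ)) ?_ hr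
    rintro t (rfl | rfl | rfl)
    · exact (h μ ν).1
    · exact (h μ ν).2.1
    · exact (h μ ν).2.2

end SymQuad

/-! ### The two matching versions of Poisson algebras -/

namespace SymQuadData

variable {k : Type u} [Field k]

variable (k) in
/-- The basis of products and brackets of `Ω` copies of the Poisson generators. -/
def poissonBasis (Ω : Type w) : Module.Basis (Ω × Bool) k (Ω →₀ k × k) :=
  (Finsupp.basis fun _ : Ω =>
    -- `finTwoEquiv` sends `0` to `false`; the negation makes `true` the index of the product `(1,
    -- 0)`.
    (Module.Basis.finTwoProd k).reindex (finTwoEquiv.trans Equiv.boolNot)).reindex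
      (Equiv.sigmaEquivProd Ω Bool)

theorem poissonBasis_true (Ω : Type w) (ω : Ω) :
    poissonBasis k Ω (ω, true) = Finsupp.single ω (1, 0) := by
  simp [poissonBasis, Finsupp.coe_basis, finTwoEquiv]

theorem poissonBasis_false (Ω : Type w) (ω : Ω) :
    poissonBasis k Ω (ω, false) = Finsupp.single ω (0, 1) := by
  simp [poissonBasis, Finsupp.coe_basis, finTwoEquiv]

theorem copiesSwap_poissonBasis_true (Ω : Type w) (ω : Ω) :
    copiesSwap Ω (poissonSwap k) (poissonBasis k Ω (ω, true)) = poissonBasis k Ω (ω, true) := by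
  simp [poissonBasis_true, copiesSwap, poissonSwap]

theorem copiesSwap_poissonBasis_false (Ω : Type w) (ω : Ω) :
    copiesSwap Ω (poissonSwap k) (poissonBasis k Ω (ω, false)) = -poissonBasis k Ω (ω, false) := by
  simp [poissonBasis_false, copiesSwap, poissonSwap, ← Finsupp.single_neg]

theorem isKoszulSelfDual_matchingPoissonByKind (Ω : Type w) [Finite Ω] :
    (matchingPoissonByKind k Ω).IsKoszulSelfDual := by
  let b : Module.Basis (Ω × Bool) k (matchingPoissonByKind k Ω).E := poissonBasis k Ω
  let c : Ω → (matchingPoissonByKind k Ω).E := fun ω => (Finsupp.single ω (1, 0) : Ω →₀ k × k)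
  let l : Ω → (matchingPoissonByKind k Ω).E := fun ω => (Finsupp.single ω (0, 1) : Ω →₀ k × k)
  have ht : ∀ ω, b (ω, true) = c ω := poissonBasis_true Ω
  have hf : ∀ ω, b (ω, false) = l ω := poissonBasis_false Ω
  -- In this variant the inner operation carries `μ` on the left of the Leibniz rule and `ν` on the
  -- right, whence the exchange of labels.
  refine isKoszulSelfDual_of_hasPoissonRel _ b (s := Prod.swap) Prod.swap_swap
    (copiesSwap_poissonBasis_true Ω) (copiesSwap_poissonBasis_false Ω) ?_ fun N hN h => ?_
  · intro ω
    simp only [ht, hf]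
    exact ⟨SymQuad.subset_stableSpan _ _ ⟨ω.1, ω.2, .inl rfl⟩,
      SymQuad.subset_stableSpan _ _ ⟨ω.1, ω.2, .inr (.inl rfl)⟩,
      SymQuad.subset_stableSpan _ _ ⟨ω.1, ω.2, .inr (.inr rfl)⟩⟩
  · refine SymQuad.stableSpan_le hN ?_
    rintro t ⟨μ, ν, h'⟩
    have h1 := h (μ, ν)
    simp only [ht, hf] at h1
    rcases h' with rfl | rfl | rfl
    · exact h1.1
    · exact h1.2.1
    · exact h1.2.2

theorem isKoszulSelfDual_matching_poisson (Ω : Type w) [Finite Ω] :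
    ((poisson k).matching Ω).IsKoszulSelfDual := by
  let b : Module.Basis (Ω × Bool) k ((poisson k).matching Ω).E := poissonBasis k Ω
  let i : Ω → (poisson k).E →ₗ[k] ((poisson k).matching Ω).E :=
    fun μ => Finsupp.lsingle (R := k) μ
  let c : (poisson k).E := ((1, 0) : k × k)
  let l : (poisson k).E := ((0, 1) : k × k)
  have ht : ∀ ω, b (ω, true) = i ω c := poissonBasis_true Ω
  have hf : ∀ ω, b (ω, false) = i ω l := poissonBasis_false Ω
  have hi : ∀ ω e, i ω ((poisson k).swap e) = ((poisson k).matching Ω).swap (i ω e) := by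
    intro ω e
    exact (Finsupp.mapRange_single (hf := map_zero (poisson k).swap)).symm
  have key := fun N (hN : SymQuad.IsStable ((poisson k).matching Ω).swap N) =>
    SymQuad.stableSpan_map₂_le_iff i hi c l hN
  simp only [← ht, ← hf] at key
  -- In the matching operad labels are attached to positions, inner `μ` and outer `ν` on both sides,
  -- so nothing is permuted.
  exact isKoszulSelfDual_of_hasPoissonRel _ b (s := id) (fun _ => rfl)
    (copiesSwap_poissonBasis_true Ω) (copiesSwap_poissonBasis_false Ω)
    (fun ω => (key _ ((poisson k).matching Ω).stable).1 le_rfl ω.1 ω.2)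
    fun N hN h => (key N hN).2 fun μ ν => h (μ, ν)

end SymQuadData

end

theorem mainTheorem10 {k : Type u} [Field k] [CharZero k] (Ω : Type v) [Finite Ω] [Nonempty Ω] :
    ((NSQuadData.assoc k).matching Ω).IsKoszulSelfDual ∧
      ((SymQuadData.poisson k).matching Ω).IsKoszulSelfDual ∧
      (SymQuadData.matchingPoissonByKind k Ω).IsKoszulSelfDual :=
  ⟨NSQuadData.isKoszulSelfDual_matching_assoc Ω,
    SymQuadData.isKoszulSelfDual_matching_poisson Ω,
    SymQuadData.isKoszulSelfDual_matchingPoissonByKind Ω⟩
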